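/- **Setting.** Let $(\overline M,\overline g)$ be a smooth semi-Riemannian manifold of constant index and constant sectional curvature $c$, with Levi-Civita connection $\overline\nabla$, and let $f:M\to\overline M$ be an immersed lightlike hypersurface, i.e. $\dim\overline M=\dim M+1$ and the radical $\mathrm{Rad}\,T_uM=\{x\in T_uM: g(x,y)=0\ \forall y\in T_uM\}$ of the induced metric $g=f^*\overline g$ has dimension $1$ for every $u\in M$. A *screen distribution* $S(TM)$ is a smooth distribution on $M$ with $TM=\mathrm{Rad}\,TM\oplus S(TM)$. A *normalizing pair* of $S(TM)$ on an open set $U\subset M$ consists of a smooth section $\xi$ of $\mathrm{Rad}\,TM$ and a smooth section $N$ of $f^*T\overline M$ over $U$ with $$\overline g(\xi,N)=1,\qquad \overline g(N,N)=0,\qquad \overline g(N,W)=0\ \text{ for all } W\in S(TM).$$ The Gauss and Weingarten formulas $$\overline\nabla_XY=\nabla_XY+B(X,Y)N,\qquad \overline\nabla_XN=-A_NX+\tau(X)N$$ (with $\nabla_XY$, $A_NX$ tangent to $M$) define the induced connection $\nabla$, the local second fundamental form $B$ and the shape operator $A_N$. Let $R(X,Y)=\nabla_X\nabla_Y-\nabla_Y\nabla_X-\nabla_{[X,Y]}$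 and $R(X,Y,Z,T)=g(R(X,Y)Z,T)$. The curvature $R$ and the vector field $A_N\xi$ depend only on $S(TM)$, not on the pair $\{\xi,N\}$. * $S(TM)$ is *admissible* if at every point $R(x,y,z,w)=-R(y,x,z,w)=R(z,w,x,y)$ and $R(x,y,z,w)+R(y,z,x,w)+R(z,x,y,w)=0$. * For an admissible screen and $x\in T_uM$, the *pseudo-Jacobi operator* $J_R(x)$ is the linear map of $T_uM$ given by $\tilde g(J_R(x)y,w)=R(y,x,x,w)$ for all $y,w$, where $\tilde g=g+\eta\otimes\eta$ and $\eta=\overline g(\cdot,N)$. $M$ is *timelike* (resp. *spacelike*) *Osserman at* $u$ if for each admissible screen the characteristic polynomial of $J_R(x)$ is the same for all $x\in T_uM$ with $g(x,x)=-1$ (resp. $g(x,x)=1$). $M$ is *pointwise Osserman* if at each $u\in M$ it is timelike or spacelike Osserman. * $(M,g,S(TM))$ is *semi-symmetric* if for all $V_1,V_2,X,Y,Z,T$ tangent to $M$ $$-R(R(V_1,V_2)X,Y,Z,T)-R(X,R(V_1,V_2)Y,Z,T)-R(X,Y,R(V_1,V_2)Z,T)-R(X,Y,Z,R(V_1,V_2)T)=0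 .$$ * It is *totally geodesic* if $B=0$ identically, i.e. the second fundamental form $h=B\otimes N$ vanishes. **Theorem 5.3.** Let $M$ be a pointwise Osserman lightlike hypersurface of a semi-Riemannian manifold of constant sectional curvature, and let $S(TM)$ be an admissible screen distribution on $M$ such that $A_N\xi$ is non-null, that is, $g(A_N\xi,A_N\xi)\neq 0$ at every point of $M$. Then $(M,g,S(TM))$ is semi-symmetric if and only if it is totally geodesic. -/

import Mathlib

open scoped Manifold ContDiff Bundle Topology

noncomputable section

namespace Lightlike

/-! ### Coordinate formulas -/

section Coordinates

variable {E : Type*} [NormedAddCommGroup E] [NormedSpace ℝ E]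
  {E' : Type*} [NormedAddCommGroup E'] [NormedSpace ℝ E']

/-- The pullback `(v, w) ↦ b(A v, A w)` of a bilinear form. -/
def pullbackForm (b : E' →L[ℝ] E' →L[ℝ] ℝ) (A : E →L[ℝ] E') : E →L[ℝ] E →L[ℝ] ℝ :=
  b.bilinearComp A A

/-- The Christoffel symbols of the Levi-Civita connection of a metric `G` given in coordinates.
`christoffel G y v w` is the value at `y` of `∇_v ∂_w`, where `∂_w` is the constant vector field
`w`; it is the vector `Γ` determined by the Koszul formula
`2 G(Γ, z) = ∂_v G(w, z) + ∂_w G(v, z) - ∂_z G(v, w)` for all `z`.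
(The inverse of `G y : E → E*` raises the index.) -/
def christoffel (G : E → E →L[ℝ] E →L[ℝ] ℝ) (y v w : E) : E :=
  (G y).inverse
    ((2⁻¹ : ℝ) • (fderiv ℝ G y v w + fderiv ℝ G y w v - ((fderiv ℝ G y).flip v).flip w))

/-- The curvature operator `R(v, w) z = ∇_v ∇_w ∂_z - ∇_w ∇_v ∂_z` at `y` of the connection with
Christoffel symbols `Γ y v w = ∇_v ∂_w`, for constant (hence commuting) fields `v`, `w`, `z`. -/
def curvatureOf (Γ : E → E → E → E) (y v w z : E) : E :=
  fderiv ℝ (fun y' => Γ y' w z) y v - fderiv ℝ (fun y' => Γ y' v z) y w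
    + Γ y v (Γ y w z) - Γ y w (Γ y v z)

/-- The ambient covariant derivative `∇̄_v V` at `y` of a vector field `V` along the map `F`,
with respect to the Levi-Civita connection of `G`. -/
def covAlong (G : E' → E' →L[ℝ] E' →L[ℝ] ℝ) (F V : E → E') (y v : E) : E' :=
  fderiv ℝ V y v + christoffel G (F y) (fderiv ℝ F y v) (V y)

/-- The decomposition `V = dF(X) + a n` of an ambient vector `V` at `F y` into a tangential part
and a multiple of a vector `n` that is transversal to the hypersurface `F`; the result is the pair
`(X, a)`. -/
def decomp (F : E → E') (n : E') (y : E) (V : E') : E × ℝ :=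
  ((fderiv ℝ F y).coprod (ContinuousLinearMap.toSpanSingleton ℝ n)).inverse V

/-- Gauss formula, tangential part: the Christoffel symbols of the connection induced on the
hypersurface `F` by the transversal field `n`, from `∇̄_v dF(w) = dF(∇_v w) + B(v, w) n`. -/
def inducedChristoffel (G : E' → E' →L[ℝ] E' →L[ℝ] ℝ) (F n : E → E') (y v w : E) : E :=
  (decomp F (n y) y (covAlong G F (fun y' => fderiv ℝ F y' w) y v)).1

/-- Gauss formula, transversal part: the local second fundamental form `B(v, w)`. -/
def localSecondForm (G : E' → E' →L[ℝ] E' →L[ℝ] ℝ) (F n : E → E') (y v w : E) : ℝ :=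
  (decomp F (n y) y (covAlong G F (fun y' => fderiv ℝ F y' w) y v)).2

/-- Weingarten formula: the shape operator `A_n`, from `∇̄_v n = - dF(A_n v) + τ(v) n`. -/
def localShape (G : E' → E' →L[ℝ] E' →L[ℝ] ℝ) (F n : E → E') (y v : E) : E :=
  -(decomp F (n y) y (covAlong G F n y v)).1

end Coordinates

/-! ### Semi-Riemannian manifolds -/

section Ambient

/-- A (smooth) semi-Riemannian metric of constant index on the manifold `N`. -/
structure SemiRiemannianMetric (E : Type*) [NormedAddCommGroup E] [NormedSpace ℝ E]
    (N : Type*) [TopologicalSpace N] [ChartedSpace E N] [IsManifold 𝓘(ℝ, E) ∞ N] where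
  /-- the bilinear form on each tangent space -/
  val : ∀ x : N, TangentSpace 𝓘(ℝ, E) x →L[ℝ] TangentSpace 𝓘(ℝ, E) x →L[ℝ] ℝ
  symm : ∀ (x : N) (v w : TangentSpace 𝓘(ℝ, E) x), val x v w = val x w v
  nondegenerate : ∀ (x : N) (v : TangentSpace 𝓘(ℝ, E) x), (∀ w, val x v w = 0) → v = 0
  contMDiff : ContMDiff 𝓘(ℝ, E) (𝓘(ℝ, E).prod 𝓘(ℝ, E →L[ℝ] E →L[ℝ] ℝ)) ∞
    (fun x : N => Bundle.TotalSpace.mk' (E →L[ℝ] E →L[ℝ] ℝ)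
      (E := fun x : N => TangentSpace 𝓘(ℝ, E) x →L[ℝ] TangentSpace 𝓘(ℝ, E) x →L[ℝ] ℝ) x (val x))
  /-- the constant index: the maximal dimension of a negative definite subspace -/
  index : ℕ
  index_spec : ∀ x : N, IsGreatest {d : ℕ | ∃ W : Submodule ℝ (TangentSpace 𝓘(ℝ, E) x),
    Module.finrank ℝ W = d ∧ ∀ w ∈ W, w ≠ 0 → val x w w < 0} index

variable {E : Type*} [NormedAddCommGroup E] [NormedSpace ℝ E]
  {N : Type*} [TopologicalSpace N] [ChartedSpace E N] [IsManifold 𝓘(ℝ, E) ∞ N]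

/-- The metric in the preferred chart at `x`, as a function of the coordinates. -/
def metricInChart (g : SemiRiemannianMetric E N) (x : N) (y : E) : E →L[ℝ] E →L[ℝ] ℝ :=
  pullbackForm (E := E) (E' := E) (g.val ((extChartAt 𝓘(ℝ, E) x).symm y))
    (mfderiv 𝓘(ℝ, E) 𝓘(ℝ, E) (extChartAt 𝓘(ℝ, E) x).symm y)

/-- The Riemann curvature operator `R̄(v, w) z` of the Levi-Civita connection at `x`, computed in
the preferred chart at `x`. (In Mathlib a vector of `TangentSpace 𝓘(ℝ, E) x` is the element of `E`
formed by its components in that chart.) -/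
def riemann (g : SemiRiemannianMetric E N) (x : N) (v w z : TangentSpace 𝓘(ℝ, E) x) :
    TangentSpace 𝓘(ℝ, E) x :=
  curvatureOf (E := E) (christoffel (metricInChart g x)) (extChartAt 𝓘(ℝ, E) x x) v w z

/-- All nondegenerate tangent planes (those spanned by `v`, `w` with
`g(v,v) g(w,w) - g(v,w)² ≠ 0`) have sectional curvature `c`. -/
def HasConstantSectionalCurvature (g : SemiRiemannianMetric E N) (c : ℝ) : Prop :=
  ∀ (x : N) (v w : TangentSpace 𝓘(ℝ, E) x),
    g.val x v v * g.val x w w - g.val x v w ^ 2 ≠ 0 →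
    g.val x (riemann g x v w w) v / (g.val x v v * g.val x w w - g.val x v w ^ 2) = c

end Ambient

/-! ### Lightlike hypersurfaces -/

section Hypersurface

variable {E : Type*} [NormedAddCommGroup E] [NormedSpace ℝ E]
  {M : Type*} [TopologicalSpace M] [ChartedSpace E M] [IsManifold 𝓘(ℝ, E) ∞ M]
  {E' : Type*} [NormedAddCommGroup E'] [NormedSpace ℝ E']
  {N : Type*} [TopologicalSpace N] [ChartedSpace E' N] [IsManifold 𝓘(ℝ, E') ∞ N]

/-- The induced (possibly degenerate) metric `f^* g` on `M`. -/
def inducedMetric (g : SemiRiemannianMetric E' N) (f : M → N) (u : M) :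
    TangentSpace 𝓘(ℝ, E) u →L[ℝ] TangentSpace 𝓘(ℝ, E) u →L[ℝ] ℝ :=
  pullbackForm (E := E) (E' := E') (g.val (f u)) (mfderiv 𝓘(ℝ, E) 𝓘(ℝ, E') f u)

/-- The radical `Rad T_u M = T_u M ∩ (T_u M)^⊥` of the induced metric. -/
def radical (g : SemiRiemannianMetric E' N) (f : M → N) (u : M) :
    Submodule ℝ (TangentSpace 𝓘(ℝ, E) u) where
  carrier := {x | ∀ y, inducedMetric g f u x y = 0}
  add_mem' := by
    intro a b ha hb y
    rw [map_add, add_apply, ha y, hb y, add_zero]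
  zero_mem' := by
    intro y
    rw [map_zero, zero_apply]
  smul_mem' := by
    intro r a ha y
    rw [map_smul, smul_apply, ha y, smul_zero]

/-- `f` is an immersion of `M` as a lightlike hypersurface of `(N, g)`: it has codimension one and
the radical of the induced metric has rank one. -/
structure IsLightlikeHypersurface (g : SemiRiemannianMetric E' N) (f : M → N) : Prop where
  contMDiff : ContMDiff 𝓘(ℝ, E) 𝓘(ℝ, E') ∞ f
  injective_mfderiv : ∀ u : M, Function.Injective (mfderiv 𝓘(ℝ, E) 𝓘(ℝ, E') f u)
  codim_one : Module.finrank ℝ E' = Module.finrank ℝ E + 1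
  finrank_radical : ∀ u : M, Module.finrank ℝ (radical (E := E) g f u) = 1

/-- A screen distribution `S(TM)`: a smooth distribution complementary to the radical distribution
in `TM`. (The induced metric is then automatically nondegenerate on it, and the sum orthogonal.) -/
structure Screen (g : SemiRiemannianMetric E' N) (f : M → N) where
  /-- the subspace of the tangent space at each point -/
  space : ∀ u : M, Submodule ℝ (TangentSpace 𝓘(ℝ, E) u)
  isCompl : ∀ u : M, IsCompl (radical g f u) (space u)
  smooth : ∀ u : M, ∃ U : Set M, IsOpen U ∧ u ∈ U ∧
    ∃ (k : ℕ) (W : Fin k → ∀ p : M, TangentSpace 𝓘(ℝ, E) p),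
      (∀ i, ContMDiffOn 𝓘(ℝ, E) 𝓘(ℝ, E).tangent ∞
        (fun p => (⟨p, W i p⟩ : TangentBundle 𝓘(ℝ, E) M)) U) ∧
      ∀ p ∈ U, LinearIndependent ℝ (fun i => W i p) ∧
        Submodule.span ℝ (Set.range fun i => W i p) = space p

/-- A normalizing pair `{ξ, N}` of the screen `S` on the open set `U`: a smooth section `ξ` of
`Rad TM` and a smooth section `ν` of `f^* TN` over `U` with `ν ⟂ S(TM)`, `g(ξ, ν) = 1`,
`g(ν, ν) = 0`. The field `ν` spans the lightlike transversal bundle `ltr(TM) = tr(TM)` over `U`. -/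
structure IsNormalizingPair {g : SemiRiemannianMetric E' N} {f : M → N} (S : Screen (E := E) g f)
    (U : Set M) (ξ : ∀ p : M, TangentSpace 𝓘(ℝ, E) p)
    (ν : ∀ p : M, TangentSpace 𝓘(ℝ, E') (f p)) : Prop where
  isOpen : IsOpen U
  smooth_rad : ContMDiffOn 𝓘(ℝ, E) 𝓘(ℝ, E).tangent ∞
    (fun p => (⟨p, ξ p⟩ : TangentBundle 𝓘(ℝ, E) M)) U
  smooth_trans : ContMDiffOn 𝓘(ℝ, E) 𝓘(ℝ, E').tangent ∞
    (fun p => (⟨f p, ν p⟩ : TangentBundle 𝓘(ℝ, E') N)) U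
  mem_radical : ∀ p ∈ U, ξ p ∈ radical g f p
  pairing : ∀ p ∈ U, g.val (f p) (mfderiv 𝓘(ℝ, E) 𝓘(ℝ, E') f p (ξ p)) (ν p) = 1
  null : ∀ p ∈ U, g.val (f p) (ν p) (ν p) = 0
  orthogonal : ∀ p ∈ U, ∀ w ∈ S.space p,
    g.val (f p) (mfderiv 𝓘(ℝ, E) 𝓘(ℝ, E') f p w) (ν p) = 0

/-- The immersion `f` in the preferred charts at `u` and at `f u`. -/
def mapInChart (f : M → N) (u : M) : E → E' :=
  writtenInExtChartAt 𝓘(ℝ, E) 𝓘(ℝ, E') u f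

/-- A vector field `ν` along `f`, in the preferred charts at `u` and at `f u`. -/
def alongInChart (f : M → N) (ν : ∀ p : M, TangentSpace 𝓘(ℝ, E') (f p)) (u : M) (y : E) : E' :=
  mfderiv 𝓘(ℝ, E') 𝓘(ℝ, E') (extChartAt 𝓘(ℝ, E') (f u))
    (f ((extChartAt 𝓘(ℝ, E) u).symm y)) (ν ((extChartAt 𝓘(ℝ, E) u).symm y))

/-- The curvature operator `R(x, y) z` at `u` of the connection induced on `M` by the Levi-Civita
connection of `g` and the transversal bundle spanned by `ν`. -/
def inducedCurvature (g : SemiRiemannianMetric E' N) (f : M → N)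
    (ν : ∀ p : M, TangentSpace 𝓘(ℝ, E') (f p)) (u : M) (x y z : TangentSpace 𝓘(ℝ, E) u) :
    TangentSpace 𝓘(ℝ, E) u :=
  curvatureOf (E := E) (inducedChristoffel (metricInChart g (f u)) (mapInChart f u) (alongInChart f ν u))
    (extChartAt 𝓘(ℝ, E) u u) x y z

/-- The `(0,4)` curvature `R(x, y, z, w) = g(R(x, y) z, w)` of the induced connection. -/
def inducedCurvature₄ (g : SemiRiemannianMetric E' N) (f : M → N)
    (ν : ∀ p : M, TangentSpace 𝓘(ℝ, E') (f p)) (u : M) (x y z w : TangentSpace 𝓘(ℝ, E) u) : ℝ :=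
  inducedMetric g f u (inducedCurvature g f ν u x y z) w

/-- The local second fundamental form `B(x, y)` at `u` relative to `ν`: `h(x, y) = B(x, y) ν`. -/
def secondForm (g : SemiRiemannianMetric E' N) (f : M → N)
    (ν : ∀ p : M, TangentSpace 𝓘(ℝ, E') (f p)) (u : M) (x y : TangentSpace 𝓘(ℝ, E) u) : ℝ :=
  localSecondForm (E := E) (metricInChart g (f u)) (mapInChart f u) (alongInChart f ν u)
    (extChartAt 𝓘(ℝ, E) u u) x y

/-- The shape operator `A_ν x` at `u`. -/
def shape (g : SemiRiemannianMetric E' N) (f : M → N)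
    (ν : ∀ p : M, TangentSpace 𝓘(ℝ, E') (f p)) (u : M) (x : TangentSpace 𝓘(ℝ, E) u) :
    TangentSpace 𝓘(ℝ, E) u :=
  localShape (E := E) (metricInChart g (f u)) (mapInChart f u) (alongInChart f ν u)
    (extChartAt 𝓘(ℝ, E) u u) x

/-- `R` is an algebraic curvature tensor on `V`. -/
def IsAlgebraicCurvature {V : Type*} (R : V → V → V → V → ℝ) : Prop :=
  (∀ x y z w, R x y z w = -R y x z w) ∧ (∀ x y z w, R x y z w = R z w x y) ∧
    ∀ x y z w, R x y z w + R y z x w + R z x y w = 0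

/-- The screen is admissible: its induced curvature is an algebraic curvature tensor at each
point. (The induced curvature does not depend on the choice of the normalizing pair.) -/
def Screen.IsAdmissible {g : SemiRiemannianMetric E' N} {f : M → N} (S : Screen (E := E) g f) :
    Prop :=
  ∀ U ξ ν, IsNormalizingPair S U ξ ν → ∀ u ∈ U,
    IsAlgebraicCurvature (inducedCurvature₄ (E := E) g f ν u)

/-- The nondegenerate metric `g̃ = g + η ⊗ η` associated with a normalizing pair, where
`η(x) = g(x, ν)`. -/
def associatedMetric (g : SemiRiemannianMetric E' N) (f : M → N)
    (ν : ∀ p : M, TangentSpace 𝓘(ℝ, E') (f p)) (u : M) (x y : TangentSpace 𝓘(ℝ, E) u) : ℝ :=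
  inducedMetric g f u x y +
    g.val (f u) (mfderiv 𝓘(ℝ, E) 𝓘(ℝ, E') f u x) (ν u) *
      g.val (f u) (mfderiv 𝓘(ℝ, E) 𝓘(ℝ, E') f u y) (ν u)

/-- `J` is the pseudo-Jacobi operator `J_R(x)` on `T_u M`, the linear map characterized by
`g̃(J y, w) = R(y, x, x, w)` for all `y`, `w`. -/
def IsPseudoJacobi (g : SemiRiemannianMetric E' N) (f : M → N)
    (ν : ∀ p : M, TangentSpace 𝓘(ℝ, E') (f p)) (u : M) (x : TangentSpace 𝓘(ℝ, E) u)
    (J : TangentSpace 𝓘(ℝ, E) u →ₗ[ℝ] TangentSpace 𝓘(ℝ, E) u) : Prop :=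
  ∀ y w, associatedMetric g f ν u (J y) w = inducedCurvature₄ g f ν u y x x w

section FiniteDim

variable [FiniteDimensional ℝ E]

/-- For each admissible screen, the characteristic polynomial of `J_R(x)` is the same for all
`x ∈ T_u M` with `g(x, x) = ε`. For `ε = -1` this says that `M` is timelike Osserman at `u`, for
`ε = 1` that it is spacelike Osserman at `u`. -/
def IsOssermanAt (g : SemiRiemannianMetric E' N) (f : M → N) (ε : ℝ) (u : M) : Prop :=
  ∀ S : Screen (E := E) g f, S.IsAdmissible → ∀ U ξ ν, IsNormalizingPair S U ξ ν → u ∈ U →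
    ∀ x x' : TangentSpace 𝓘(ℝ, E) u,
      inducedMetric g f u x x = ε → inducedMetric g f u x' x' = ε →
      ∀ J J' : E →ₗ[ℝ] E, IsPseudoJacobi g f ν u x J → IsPseudoJacobi g f ν u x' J' →
        J.charpoly = J'.charpoly

/-- `M` is pointwise Osserman: at each point it is timelike or spacelike Osserman. -/
def IsPointwiseOsserman (g : SemiRiemannianMetric E' N) (f : M → N) : Prop :=
  ∀ u : M, IsOssermanAt (E := E) g f (-1) u ∨ IsOssermanAt (E := E) g f 1 u

end FiniteDim

/-- `A_N ξ` is a non-null vector field: `g(A_N ξ, A_N ξ) ≠ 0` at each point. (The vector `A_N ξ`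
does not depend on the choice of the normalizing pair `{ξ, N}` of the screen.) -/
def Screen.IsNonNullShape {g : SemiRiemannianMetric E' N} {f : M → N} (S : Screen (E := E) g f) :
    Prop :=
  ∀ U ξ ν, IsNormalizingPair S U ξ ν → ∀ u ∈ U,
    inducedMetric g f u (shape g f ν u (ξ u)) (shape g f ν u (ξ u)) ≠ 0

/-- `(M, g, S(TM))` is semi-symmetric: `R(v₁, v₂) · R = 0` for the `(0,4)` induced curvature. -/
def Screen.IsSemiSymmetric {g : SemiRiemannianMetric E' N} {f : M → N}
    (S : Screen (E := E) g f) : Prop :=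
  ∀ U ξ ν, IsNormalizingPair S U ξ ν → ∀ u ∈ U, ∀ v₁ v₂ x y z t : TangentSpace 𝓘(ℝ, E) u,
    - inducedCurvature₄ g f ν u (inducedCurvature g f ν u v₁ v₂ x) y z t
    - inducedCurvature₄ g f ν u x (inducedCurvature g f ν u v₁ v₂ y) z t
    - inducedCurvature₄ g f ν u x y (inducedCurvature g f ν u v₁ v₂ z) t
    - inducedCurvature₄ g f ν u x y z (inducedCurvature g f ν u v₁ v₂ t) = 0

/-- `(M, g, S(TM))` is totally geodesic: its second fundamental form `h = B ⊗ N` vanishes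
identically. -/
def Screen.IsTotallyGeodesic {g : SemiRiemannianMetric E' N} {f : M → N}
    (S : Screen (E := E) g f) : Prop :=
  ∀ U ξ ν, IsNormalizingPair S U ξ ν → ∀ u ∈ U, ∀ x y : TangentSpace 𝓘(ℝ, E) u,
    secondForm g f ν u x y = 0

end Hypersurface

end Lightlike

end

open Lightlike

/-! Write `A` for the shape operator of the transversal field `N`. In a space form the ambient
curvature is `c (g(y,z) x - g(x,z) y)`, which is tangent to `M` for tangent arguments. The
tangential part of the Gauss equation therefore reads `R(x,y)z = c (g(y,z) x - g(x,z) y) + B(y,z) A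
x - B(x,z) A y` (`IsNormalizingPair.inducedCurvature_eq`). Moreover `B(·,ξ) = 0`, by differentiating
`g(ξ,ξ) = 0` (`IsNormalizingPair.secondForm_radical`).

Admissibility includes the pair symmetry `R(ξ,x,y,Aξ) = R(y,Aξ,ξ,x)`. Since `ξ` is in the kernel of
both `g` and `B`, the left side is `B(x,y) g(Aξ,Aξ)` and the right side is `0`. As `Aξ` is non-null,
`B = 0`. Conversely, if `B = 0`, then `R(v₁,v₂)` is skew-adjoint for `g` and `R` is a polynomial in
`g`, so the derivation induced by `R(v₁,v₂)` annihilates `R`.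

Most of the work is to obtain the Gauss equation from the coordinate definitions: symmetries of the
Levi-Civita curvature, the space-form expression from sectional curvatures of nondegenerate planes
only, the derivative of the Gauss formula, and the passage between charts and tangent spaces. -/

noncomputable section

namespace Lightlike

set_option maxSynthPendingDepth 3

/-! ### Algebraic curvature tensors and their sectional curvatures. -/

section Algebra

/-- An algebraic curvature tensor is determined by its sectional curvatures. -/
theorem IsAlgebraicCurvature.eq_zero {V : Type*} [AddCommGroup V] {K : V → V → V → V → ℝ}
    (hK : IsAlgebraicCurvature K) (hadd : ∀ x x' y z w, K (x + x') y z w = K x y z w + K x' y z w)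
    (hd : ∀ x y, K x y y x = 0) (x y z w : V) : K x y z w = 0 := by
  obtain ⟨h12, hp, hb⟩ := hK
  have h34 : ∀ x y z w, K x y z w = -K x y w z := fun x y z w => by
    rw [hp, h12, hp w z]
  have add2 : ∀ x y y' z w, K x (y + y') z w = K x y z w + K x y' z w := fun x y y' z w => by
    rw [h12, hadd, h12 x y, h12 x y']; ring
  have add3 : ∀ x y z z' w, K x y (z + z') w = K x y z w + K x y z' w := fun x y z z' w => by
    rw [hp, hadd, hp z, hp z']
  have add4 : ∀ x y z w w', K x y z (w + w') = K x y z w + K x y z w' := fun x y z w w' => by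
    rw [hp, add2, hp z, hp z]
  -- Polarization: `K x · · x` is symmetric and vanishes on the diagonal. A second polarization, in
  -- `x`, makes `K` skew in its outer slots. Hence `K` is totally skew, and the Bianchi sum becomes
  -- `3 K = 0`.
  have h1 : ∀ x y z, K x y z x = 0 := fun x y z => by
    have h := hd x (y + z)
    rw [add2, add3, add3, hd, hd] at h
    have h' : K x z y x = K x y z x := by rw [hp, h12, h34]; ring
    linarith
  have h14 : ∀ x y z w, K x y z w = -K w y z x := fun x y z w => by
    have h := h1 (x + w) y z
    rw [hadd, add4, add4, h1, h1] at h
    linarith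
  have h23 : ∀ x y z w, K x y z w = -K x z y w := fun x y z w => by
    linarith [h12 x y z w, h14 y x z w, h34 w x z y, h14 w x y z, h12 z x y w]
  have e1 : K y z x w = K x y z w := by
    rw [h23, h12]; ring
  have e2 : K z x y w = K x y z w := by
    rw [h12, h23]; ring
  linarith [hb x y z w]

/-- Applied to the Gram determinant of a perturbed plane, which is a quartic in the perturbation
parameter. -/
theorem finite_quartic_eq_zero (a b c d e : ℝ) (ha : a ≠ 0) :
    {t : ℝ | a * t ^ 4 + b * t ^ 3 + c * t ^ 2 + d * t + e = 0}.Finite := by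
  let p : Polynomial ℝ := .C a * .X ^ 4 + .C b * .X ^ 3 + .C c * .X ^ 2 + .C d * .X + .C e
  have hp : p ≠ 0 := fun h => ha (by
    have := congrArg (Polynomial.coeff · 4) h
    simpa [p, Polynomial.coeff_X, Polynomial.coeff_C] using this)
  refine (p.roots.toFinset.finite_toSet).subset fun t ht => ?_
  simp only [Finset.mem_coe, Multiset.mem_toFinset, Polynomial.mem_roots hp,
    Polynomial.IsRoot.def]
  simpa [p] using ht

/-- If all nondegenerate planes have sectional curvature `c`, then the curvature tensor is the one
of a space form. -/
theorem IsAlgebraicCurvature.eq_of_sectional {V : Type*} [AddCommGroup V] [Module ℝ V]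
    {K : V → V → V → V → ℝ} (hK : IsAlgebraicCurvature K)
    (hadd : ∀ x x' y z w, K (x + x') y z w = K x y z w + K x' y z w)
    (hsmul : ∀ (r : ℝ) x y z w, K (r • x) y z w = r * K x y z w)
    (g : V →ₗ[ℝ] V →ₗ[ℝ] ℝ) (hg : ∀ x y, g x y = g y x) {e n : V} (he : g e e = 0)
    (hn : g n n = 0) (hen : g e n = 1) {c : ℝ}
    (hc : ∀ v w, g v v * g w w - g v w ^ 2 ≠ 0 → K v w w v / (g v v * g w w - g v w ^ 2) = c)
    (x y z w : V) : K x y z w = c * (g y z * g x w - g x z * g y w) := by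
  let D : V → V → V → V → ℝ := fun x y z w => K x y z w - c * (g y z * g x w - g x z * g y w)
  obtain ⟨h12, hp, hb⟩ := hK
  have add2 : ∀ x y y' z w, K x (y + y') z w = K x y z w + K x y' z w := fun x y y' z w => by
    rw [h12, hadd, h12 x y, h12 x y']; ring
  have add3 : ∀ x y z z' w, K x y (z + z') w = K x y z w + K x y z' w := fun x y z z' w => by
    rw [hp, hadd, hp z, hp z']
  have add4 : ∀ x y z w w', K x y z (w + w') = K x y z w + K x y z w' := fun x y z w w' => by
    rw [hp, add2, hp z, hp z]
  have smul2 : ∀ (r : ℝ) x y z w, K x (r • y) z w = r * K x y z w := fun r x y z w => by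
    rw [h12, hsmul, h12 x y]; ring
  have smul3 : ∀ (r : ℝ) x y z w, K x y (r • z) w = r * K x y z w := fun r x y z w => by
    rw [hp, hsmul, hp z]
  have smul4 : ∀ (r : ℝ) x y z w, K x y z (r • w) = r * K x y z w := fun r x y z w => by
    rw [hp, smul2, hp z]
  suffices h : D x y z w = 0 by simp only [D] at h; linarith
  refine IsAlgebraicCurvature.eq_zero (K := D) ⟨fun x y z w => ?_, fun x y z w => ?_,
    fun x y z w => ?_⟩ (fun x x' y z w => ?_) (fun v w => ?_) x y z w
  · simp only [D]; rw [h12]; ring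
  · simp only [D]; rw [hp, hg w x, hg z x, hg z y, hg w y]; ring
  · simp only [D]; rw [hg z x, hg z y, hg y x]; linarith [hb x y z w]
  · simp only [D]; rw [hadd]; simp only [map_add, LinearMap.add_apply]; ring
  -- The hypothesis says nothing about degenerate planes, so the plane is moved along the hyperbolic
  -- pair. The Gram determinant of `v + t e`, `w + t n` has leading coefficient `g(e,e) g(n,n) -
  -- g(e,n)² = -1` at `t⁴`, so it vanishes for finitely many `t` only. `D` is continuous in `t` and
  -- zero on a dense set, hence zero at `t = 0`.
  · let S : Set ℝ := {t | g (v + t • e) (v + t • e) * g (w + t • n) (w + t • n)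
      - g (v + t • e) (w + t • n) ^ 2 = 0}
    have hS : S.Finite := by
      refine (finite_quartic_eq_zero (-1)
        (-2 * (g v n + g e w)) (4 * g v e * g w n - (g v n + g e w) ^ 2 - 2 * g v w)
        (2 * g v e * g w w + 2 * g w n * g v v - 2 * g v w * (g v n + g e w))
        (g v v * g w w - g v w ^ 2) (by norm_num)).subset fun t ht => ?_
      simp only [S, Set.mem_ofPred_eq, map_add, LinearMap.add_apply, map_smul, LinearMap.smul_apply,
        smul_eq_mul, he, hn, hen, hg e v, hg n w] at ht ⊢
      linarith
    have hcont : Continuous fun t : ℝ => D (v + t • e) (w + t • n) (w + t • n) (v + t • e) := by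
      simp only [D, hadd, add2, add3, add4, hsmul, smul2, smul3, smul4, map_add, map_smul,
        LinearMap.add_apply, LinearMap.smul_apply, smul_eq_mul]
      fun_prop
    have h := hcont.ext_on (hS.countable.dense_compl ℝ) (continuous_const (y := (0 : ℝ)))
      (fun t ht => by
        have h1 := hc _ _ ht
        rw [div_eq_iff ht] at h1
        simp only [D]
        rw [h1, hg (w + t • n) (v + t • e)]; ring)
    simpa using congrFun h 0

end Algebra

/-- The classical octahedron argument: combine the four Bianchi identities obtained by rotating the
arguments and cancel with the two skew symmetries. -/
theorem pair_symm_of_bianchi {V : Type*} {K : V → V → V → V → ℝ}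
    (h12 : ∀ x y z w, K x y z w = -K y x z w) (h34 : ∀ x y z w, K x y z w = -K x y w z)
    (hb : ∀ x y z w, K x y z w + K y z x w + K z x y w = 0) (x y z w : V) :
    K x y z w = K z w x y := by
  linarith [hb x y z w, hb y z w x, hb z w x y, hb w x y z, h34 y z x w, h34 z x y w,
    h34 z w x y, h34 w y z x, h34 w x z y, h34 x y z w, h12 z x y w, h12 x y w z, h34 x z w y,
    h12 w x y z, h12 y w z x, h12 x w y z, h12 x z w y, h12 w y x z, h34 w x y z, h34 y w x z,
    h34 y z w x, h12 y z x w]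

/-! ### The Levi-Civita connection in coordinates and the symmetries of its curvature. -/

section LeviCivita

variable {E : Type*} [NormedAddCommGroup E] [NormedSpace ℝ E]
  {F : Type*} [NormedAddCommGroup F] [NormedSpace ℝ F]
  {F' : Type*} [NormedAddCommGroup F'] [NormedSpace ℝ F']

theorem two_le_infty : (2 : WithTop ℕ∞) ≤ ∞ :=
  WithTop.coe_le_coe.2 (le_top : (2 : ℕ∞) ≤ ⊤)

theorem fderiv_clm_apply_apply {c : E → F →L[ℝ] F'} {u : E → F} {x : E}
    (hc : DifferentiableAt ℝ c x) (hu : DifferentiableAt ℝ u x) (v : E) :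
    fderiv ℝ (fun y => c y (u y)) x v = c x (fderiv ℝ u x v) + fderiv ℝ c x v (u x) := by
  rw [fderiv_clm_apply hc hu]; rfl

theorem fderiv_clm_apply_const {c : E → F →L[ℝ] F'} {x : E}
    (hc : DifferentiableAt ℝ c x) (u : F) (v : E) :
    fderiv ℝ (fun y => c y u) x v = fderiv ℝ c x v u := by
  rw [fderiv_clm_apply_apply hc (differentiableAt_const u)]; simp

/-- The Christoffel symbols as a field of continuous bilinear maps. -/
def christoffelL (G : E → E →L[ℝ] E →L[ℝ] ℝ) (y : E) : E →L[ℝ] E →L[ℝ] E :=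
  (ContinuousLinearMap.compL ℝ E (E →L[ℝ] ℝ) E (G y).inverse) ∘L
    ((2⁻¹ : ℝ) • (fderiv ℝ G y + ContinuousLinearMap.flipₗᵢ ℝ E E (E →L[ℝ] ℝ) (fderiv ℝ G y)
      - (ContinuousLinearMap.flipₗᵢ ℝ E E ℝ).toContinuousLinearEquiv.toContinuousLinearMap ∘L
        ContinuousLinearMap.flipₗᵢ ℝ E E (E →L[ℝ] ℝ) (fderiv ℝ G y)))

theorem christoffelL_apply (G : E → E →L[ℝ] E →L[ℝ] ℝ) (y v w : E) :
    christoffelL G y v w = christoffel G y v w := rfl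

/-- `ContinuousLinearMap.inverse` is zero at non-invertible maps, so formulas involving it hold only
where invertibility does. To differentiate them, invertibility is needed on a neighbourhood. -/
theorem eventually_isInvertible [CompleteSpace F] {X : Type*} [TopologicalSpace X]
    {c : X → F →L[ℝ] F'} {x : X} (hc : ContinuousAt c x) (hx : (c x).IsInvertible) :
    ∀ᶠ y in 𝓝 x, (c y).IsInvertible := by
  obtain ⟨e, he⟩ := hx
  exact hc (ContinuousLinearEquiv.isOpen.mem_nhds ⟨e, he⟩)

variable {G : E → E →L[ℝ] E →L[ℝ] ℝ} {y₀ : E}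

theorem contDiffAt_christoffelL [CompleteSpace E] (hG : ContDiffAt ℝ ∞ G y₀)
    (hi : (G y₀).IsInvertible) : ContDiffAt ℝ ∞ (christoffelL G) y₀ := by
  have hD : ContDiffAt ℝ ∞ (fderiv ℝ G) y₀ := hG.fderiv_right le_rfl
  have hinv : ContDiffAt ℝ ∞ (fun y => (G y).inverse) y₀ :=
    ContDiffAt.comp y₀ hi.contDiffAt_map_inverse hG
  have hfl := (ContinuousLinearMap.flipₗᵢ ℝ E E (E →L[ℝ] ℝ)).contDiff.contDiffAt.comp y₀ hD
  refine ContDiffAt.clm_comp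
    ((ContinuousLinearMap.compL ℝ E (E →L[ℝ] ℝ) E).contDiff.contDiffAt.comp y₀ hinv) ?_
  exact ((hD.add hfl).sub (contDiffAt_const.clm_comp hfl)).const_smul (2⁻¹ : ℝ)

theorem fderiv_metric_symm (hs : ∀ y v w, G y v w = G y w v) {y : E} (hG : DifferentiableAt ℝ G y)
    (t v w : E) : fderiv ℝ G y t v w = fderiv ℝ G y t w v := by
  have h : ∀ v w, fderiv ℝ G y t v w = fderiv ℝ (fun y => G y v w) y t := fun v w => by
    rw [fderiv_clm_apply_const (hG.clm_apply (differentiableAt_const v)),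
      fderiv_clm_apply_const hG]
  rw [h, h]
  simp only [hs _ v w]

/-- Absence of torsion. -/
theorem christoffel_symm (hs : ∀ y v w, G y v w = G y w v) {y : E} (hG : DifferentiableAt ℝ G y)
    (v w : E) : christoffel G y v w = christoffel G y w v := by
  have : ((fderiv ℝ G y).flip v).flip w = ((fderiv ℝ G y).flip w).flip v := by
    ext z; exact fderiv_metric_symm hs hG z v w
  rw [christoffel, christoffel, this, add_comm (fderiv ℝ G y v w)]

/-- The Koszul formula, recovered from the index-raising definition. -/
theorem metric_christoffel {y : E} (hi : (G y).IsInvertible) (v w z : E) :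
    G y (christoffel G y v w) z =
      2⁻¹ * (fderiv ℝ G y v w z + fderiv ℝ G y w v z - fderiv ℝ G y z v w) := by
  rw [christoffel, hi.self_apply_inverse]; rfl

/-- The Levi-Civita connection is metric. -/
theorem fderiv_metric (hs : ∀ y v w, G y v w = G y w v) {y : E} (hG : DifferentiableAt ℝ G y)
    (hi : (G y).IsInvertible) (v w z : E) :
    fderiv ℝ G y v w z = G y (christoffel G y v w) z + G y w (christoffel G y v z) := by
  rw [hs y w, metric_christoffel hi, metric_christoffel hi, fderiv_metric_symm hs hG v z w,
    fderiv_metric_symm hs hG w v z, fderiv_metric_symm hs hG z v w]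
  ring

/-- The curvature of a connection given by a differentiable field of bilinear maps. -/
theorem curvatureOf_eq {Γ : E → E →L[ℝ] E →L[ℝ] E} {y : E} (hΓ : DifferentiableAt ℝ Γ y)
    (v w z : E) : curvatureOf (fun y v w => Γ y v w) y v w z =
      fderiv ℝ Γ y v w z - fderiv ℝ Γ y w v z + Γ y v (Γ y w z) - Γ y w (Γ y v z) := by
  have h : ∀ v w z, fderiv ℝ (fun y => Γ y w z) y v = fderiv ℝ Γ y v w z := fun v w z => by
    rw [fderiv_clm_apply_const (hΓ.clm_apply (differentiableAt_const w)),
      fderiv_clm_apply_const hΓ]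
  rw [curvatureOf, h, h]

theorem curvatureOf_christoffel_eq [CompleteSpace E] (hG : ContDiffAt ℝ ∞ G y₀)
    (hi : (G y₀).IsInvertible) (v w z : E) : curvatureOf (christoffel G) y₀ v w z =
      fderiv ℝ (christoffelL G) y₀ v w z - fderiv ℝ (christoffelL G) y₀ w v z
        + christoffelL G y₀ v (christoffelL G y₀ w z)
        - christoffelL G y₀ w (christoffelL G y₀ v z) :=
  curvatureOf_eq ((contDiffAt_christoffelL hG hi).differentiableAt (by simp)) v w z

/-- `ContDiffAt ℝ ∞` at a point gives, for each finite order, a neighbourhood depending on that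
order; two derivatives are all that is needed near the point. -/
theorem eventually_contDiffAt_two {f : E → F} {x : E} (hf : ContDiffAt ℝ ∞ f x) :
    ∀ᶠ y in 𝓝 x, ContDiffAt ℝ 2 f y :=
  (hf.of_le (m := 2) two_le_infty).eventually (by simp)

theorem eventually_differentiableAt {f : E → F} {x : E} (hf : ContDiffAt ℝ ∞ f x) :
    ∀ᶠ y in 𝓝 x, DifferentiableAt ℝ f y :=
  (eventually_contDiffAt_two hf).mono fun _ h => h.differentiableAt (by simp)

theorem fderiv_fderiv_symm {f : E → F} {x : E} (hf : ContDiffAt ℝ ∞ f x) (v w : E) :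
    fderiv ℝ (fderiv ℝ f) x v w = fderiv ℝ (fderiv ℝ f) x w v :=
  (hf.isSymmSndFDerivAt (by simpa using two_le_infty)).eq v w

/-- The curvature operator of the Levi-Civita connection is skew-adjoint. -/
theorem metric_curvatureOf_skew [CompleteSpace E] (hG : ContDiffAt ℝ ∞ G y₀)
    (hs : ∀ y v w, G y v w = G y w v) (hi : (G y₀).IsInvertible) (v w z t : E) :
    G y₀ (curvatureOf (christoffel G) y₀ v w z) t
      = -G y₀ (curvatureOf (christoffel G) y₀ v w t) z := by
  have dG : DifferentiableAt ℝ G y₀ := hG.differentiableAt (by simp)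
  have dD : DifferentiableAt ℝ (fderiv ℝ G) y₀ :=
    (hG.fderiv_right (m := ∞) le_rfl).differentiableAt (by simp)
  have dΓ : DifferentiableAt ℝ (christoffelL G) y₀ :=
    (contDiffAt_christoffelL hG hi).differentiableAt (by simp)
  have cst : ∀ a : E, DifferentiableAt ℝ (fun _ : E => a) y₀ := fun a => differentiableAt_const a
  -- Derivative along `v` of the metric compatibility identity `∂_w G(z,t) = G(∇_w z, t) + G(z, ∇_w
  -- t)`.
  have key : ∀ v w : E, fderiv ℝ (fderiv ℝ G) y₀ v w z t =
      G y₀ (fderiv ℝ (christoffelL G) y₀ v w z) t + fderiv ℝ G y₀ v (christoffelL G y₀ w z) t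
      + (G y₀ (fderiv ℝ (christoffelL G) y₀ v w t) z
        + fderiv ℝ G y₀ v (christoffelL G y₀ w t) z) := fun v w => by
    have hev : (fun y => fderiv ℝ G y w z t) =ᶠ[𝓝 y₀]
        fun y => G y (christoffelL G y w z) t + G y (christoffelL G y w t) z := by
      filter_upwards [eventually_differentiableAt hG,
        eventually_isInvertible dG.continuousAt hi] with y h1 h2
      rw [fderiv_metric hs h1 h2, hs y z]; rfl
    have hv := congrArg (fun L : E →L[ℝ] ℝ => L v) hev.fderiv_eq
    have h1 : ∀ z, DifferentiableAt ℝ (fun y => christoffelL G y w z) y₀ := fun z =>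
      (dΓ.clm_apply (cst w)).clm_apply (cst z)
    have h2 : ∀ z, DifferentiableAt ℝ (fun y => G y (christoffelL G y w z)) y₀ := fun z =>
      dG.clm_apply (h1 z)
    have h3 : ∀ z, fderiv ℝ (fun y => christoffelL G y w z) y₀ v
        = fderiv ℝ (christoffelL G) y₀ v w z := fun z => by
      rw [fderiv_clm_apply_const (dΓ.clm_apply (cst w)), fderiv_clm_apply_const dΓ]
    rw [fderiv_fun_add ((h2 z).clm_apply (cst t)) ((h2 t).clm_apply (cst z))] at hv
    simp only [add_apply] at hv
    rw [fderiv_clm_apply_const ((dD.clm_apply (cst w)).clm_apply (cst z)),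
      fderiv_clm_apply_const (dD.clm_apply (cst w)), fderiv_clm_apply_const dD,
      fderiv_clm_apply_const (h2 z), fderiv_clm_apply_const (h2 t),
      fderiv_clm_apply_apply dG (h1 z), fderiv_clm_apply_apply dG (h1 t), h3, h3] at hv
    simpa only [add_apply] using hv
  have k1 := key v w
  have k2 := key w v
  -- Second derivatives of `G` commute, so subtracting the two instances removes them and leaves
  -- `G(R(v,w)z, t) + G(R(v,w)t, z) = 0`.
  rw [fderiv_fderiv_symm hG] at k1
  simp only [fderiv_metric hs dG hi, ← christoffelL_apply] at k1 k2
  rw [curvatureOf_christoffel_eq hG hi, curvatureOf_christoffel_eq hG hi]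
  simp only [map_add, map_sub, add_apply, sub_apply]
  linarith [hs y₀ (christoffelL G y₀ w z) (christoffelL G y₀ v t),
    hs y₀ (christoffelL G y₀ v z) (christoffelL G y₀ w t)]

/-- The first Bianchi identity. -/
theorem curvatureOf_christoffel_bianchi [CompleteSpace E] (hG : ContDiffAt ℝ ∞ G y₀)
    (hs : ∀ y v w, G y v w = G y w v) (hi : (G y₀).IsInvertible) (v w z : E) :
    curvatureOf (christoffel G) y₀ v w z + curvatureOf (christoffel G) y₀ w z v
      + curvatureOf (christoffel G) y₀ z v w = 0 := by
  have dΓ : DifferentiableAt ℝ (christoffelL G) y₀ :=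
    (contDiffAt_christoffelL hG hi).differentiableAt (by simp)
  have cst : ∀ a : E, DifferentiableAt ℝ (fun _ : E => a) y₀ := fun a => differentiableAt_const a
  have hsym : ∀ v w, christoffelL G y₀ v w = christoffelL G y₀ w v :=
    christoffel_symm hs (hG.differentiableAt (by simp))
  -- Torsion-freeness holds near the point, so it passes to the derivative of the Christoffel
  -- symbols; the cyclic sum then cancels termwise.
  have hd : ∀ v w z, fderiv ℝ (christoffelL G) y₀ v w z = fderiv ℝ (christoffelL G) y₀ v z w := by
    intro v w z
    have h : ∀ w z, fderiv ℝ (christoffelL G) y₀ v w z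
        = fderiv ℝ (fun y => christoffelL G y w z) y₀ v := fun w z => by
      rw [fderiv_clm_apply_const (dΓ.clm_apply (cst w)), fderiv_clm_apply_const dΓ]
    rw [h, h]
    refine congrArg (fun L : E →L[ℝ] E => L v) (Filter.EventuallyEq.fderiv_eq ?_)
    filter_upwards [eventually_differentiableAt hG] with y hy using christoffel_symm hs hy w z
  simp only [curvatureOf_christoffel_eq hG hi]
  rw [hd v w z, hd w z v, hd z v w, hsym v w, hsym w z, hsym z v]
  abel

theorem isAlgebraicCurvature_curvatureOf [CompleteSpace E] (hG : ContDiffAt ℝ ∞ G y₀)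
    (hs : ∀ y v w, G y v w = G y w v) (hi : (G y₀).IsInvertible) :
    IsAlgebraicCurvature fun x y z w => G y₀ (curvatureOf (christoffel G) y₀ x y z) w := by
  have h12 : ∀ x y z w, G y₀ (curvatureOf (christoffel G) y₀ x y z) w
      = -G y₀ (curvatureOf (christoffel G) y₀ y x z) w := fun x y z w => by
    rw [← neg_apply, ← map_neg]
    congr 2
    simp only [curvatureOf]; abel
  have hb : ∀ x y z w, G y₀ (curvatureOf (christoffel G) y₀ x y z) w
      + G y₀ (curvatureOf (christoffel G) y₀ y z x) w
      + G y₀ (curvatureOf (christoffel G) y₀ z x y) w = 0 := fun x y z w => by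
    rw [← add_apply, ← map_add, ← add_apply, ← map_add,
      curvatureOf_christoffel_bianchi hG hs hi]
    simp
  have h34 := metric_curvatureOf_skew hG hs hi
  refine ⟨h12, fun x y z w => ?_, hb⟩
  exact pair_symm_of_bianchi h12 h34 hb x y z w

end LeviCivita

/-! ### Gauss and Weingarten formulas, and the Gauss equation, in coordinates. -/

section GaussWeingarten

variable {E : Type*} [NormedAddCommGroup E] [NormedSpace ℝ E]
  {E' : Type*} [NormedAddCommGroup E'] [NormedSpace ℝ E']

/-- The frame map `(X, a) ↦ dF(X) + a n` of a hypersurface with transversal vector `n`. -/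
def frameMap (F n : E → E') (y : E) : E × ℝ →L[ℝ] E' :=
  (fderiv ℝ F y).coprod (ContinuousLinearMap.toSpanSingleton ℝ (n y))

theorem frameMap_apply (F n : E → E') (y : E) (p : E × ℝ) :
    frameMap F n y p = fderiv ℝ F y p.1 + p.2 • n y := by
  simp [frameMap]

theorem frameMap_decomp {F n : E → E'} {y : E} (h : (frameMap F n y).IsInvertible) (V : E') :
    fderiv ℝ F y (decomp F (n y) y V).1 + (decomp F (n y) y V).2 • n y = V := by
  rw [← frameMap_apply]
  exact h.self_apply_inverse V

theorem contDiffAt_frameMap {F n : E → E'} {y₀ : E} (hF : ContDiffAt ℝ ∞ F y₀)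
    (hn : ContDiffAt ℝ ∞ n y₀) : ContDiffAt ℝ ∞ (frameMap F n) y₀ := by
  have hD : ContDiffAt ℝ ∞ (fderiv ℝ F) y₀ := hF.fderiv_right le_rfl
  have h2 : ContDiffAt ℝ ∞ (fun y => ContinuousLinearMap.toSpanSingleton ℝ (n y)) y₀ :=
    (ContinuousLinearMap.toSpanSingletonCLE (𝕜 := ℝ) (E := E')).contDiff.contDiffAt.comp y₀ hn
  exact (ContinuousLinearMap.coprodEquivL ℝ
    (𝕜 := ℝ) (E := E) (F := ℝ) (G := E')).contDiff.contDiffAt.comp y₀ (hD.prodMk h2)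

variable {G : E' → E' →L[ℝ] E' →L[ℝ] ℝ} {F n : E → E'} {y₀ : E}

theorem covAlong_fderiv_eq {y : E} (hF : ContDiffAt ℝ 2 F y) (w z : E) :
    covAlong G F (fun y' => fderiv ℝ F y' z) y w = fderiv ℝ (fderiv ℝ F) y w z
      + christoffelL G (F y) (fderiv ℝ F y w) (fderiv ℝ F y z) := by
  have : DifferentiableAt ℝ (fderiv ℝ F) y :=
    (hF.fderiv_right (m := 1) (by norm_num)).differentiableAt (by simp)
  rw [covAlong, fderiv_clm_apply_const this, christoffelL_apply]

/-- The Gauss formula. -/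
theorem gauss_formula {y : E} (hF : ContDiffAt ℝ 2 F y) (hP : (frameMap F n y).IsInvertible)
    (w z : E) : fderiv ℝ F y (inducedChristoffel G F n y w z) + localSecondForm G F n y w z • n y
      = fderiv ℝ (fderiv ℝ F) y w z
        + christoffelL G (F y) (fderiv ℝ F y w) (fderiv ℝ F y z) := by
  rw [← covAlong_fderiv_eq hF]
  exact frameMap_decomp hP _

/-- The Weingarten formula. -/
theorem weingarten_formula {y : E} (hP : (frameMap F n y).IsInvertible) (v : E) :
    ∃ τ : ℝ, fderiv ℝ n y v + christoffelL G (F y) (fderiv ℝ F y v) (n y)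
      = -fderiv ℝ F y (localShape G F n y v) + τ • n y := by
  refine ⟨(decomp F (n y) y (covAlong G F n y v)).2, ?_⟩
  rw [localShape, map_neg, neg_neg, frameMap_decomp hP]
  rfl

/-- Both ingredients of the ambient derivative are symmetric: the Hessian of `F` and the
torsion-free Christoffel symbols. -/
theorem localSecondForm_symm (hG : DifferentiableAt ℝ G (F y₀)) (hs : ∀ y v w, G y v w = G y w v)
    (hF : ContDiffAt ℝ ∞ F y₀) (v w : E) :
    localSecondForm G F n y₀ v w = localSecondForm G F n y₀ w v := by
  have h2 : ContDiffAt ℝ 2 F y₀ := hF.of_le two_le_infty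
  rw [localSecondForm, localSecondForm, covAlong_fderiv_eq h2, covAlong_fderiv_eq h2,
    fderiv_fderiv_symm hF, christoffelL_apply, christoffel_symm hs hG, christoffelL_apply]

/-- The radical direction of a lightlike hypersurface lies in the kernel of the second fundamental
form. -/
theorem localSecondForm_radical (hG : ContDiffAt ℝ ∞ G (F y₀))
    (hs : ∀ y v w, G y v w = G y w v) (hi : (G (F y₀)).IsInvertible) (hF : ContDiffAt ℝ ∞ F y₀)
    (hP : (frameMap F n y₀).IsInvertible) {ξ : E → E} (hξ : DifferentiableAt ℝ ξ y₀)
    (hrad : ∀ᶠ y in 𝓝 y₀, ∀ z, G (F y) (fderiv ℝ F y (ξ y)) (fderiv ℝ F y z) = 0)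
    (hpair : G (F y₀) (fderiv ℝ F y₀ (ξ y₀)) (n y₀) ≠ 0) (w : E) :
    localSecondForm G F n y₀ w (ξ y₀) = 0 := by
  have cst : ∀ a : E, DifferentiableAt ℝ (fun _ : E => a) y₀ := fun a => differentiableAt_const a
  have dF : DifferentiableAt ℝ F y₀ := hF.differentiableAt (by simp)
  have dG : DifferentiableAt ℝ G (F y₀) := hG.differentiableAt (by simp)
  have dD : DifferentiableAt ℝ (fderiv ℝ F) y₀ :=
    (hF.fderiv_right (m := ∞) le_rfl).differentiableAt (by simp)
  have dGF : DifferentiableAt ℝ (fun y => G (F y)) y₀ := DifferentiableAt.comp y₀ dG dF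
  have dDξ : DifferentiableAt ℝ (fun y => fderiv ℝ F y (ξ y)) y₀ := dD.clm_apply hξ
  have hev : (fun y => G (F y) (fderiv ℝ F y (ξ y)) (fderiv ℝ F y (ξ y))) =ᶠ[𝓝 y₀]
      fun _ => (0 : ℝ) := hrad.mono fun y hy => hy (ξ y)
  -- Differentiating `G(dF ξ, dF ξ) = 0` along `w` gives `G(∇̄_w dF(ξ), dF ξ) = 0`.
  have hw := congrArg (fun L : E →L[ℝ] ℝ => L w) hev.fderiv_eq
  have hcomp : fderiv ℝ (fun y => G (F y)) y₀ w = fderiv ℝ G (F y₀) (fderiv ℝ F y₀ w) := by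
    rw [fderiv_fun_comp y₀ dG dF]; rfl
  rw [fderiv_clm_apply_apply (dGF.clm_apply dDξ) dDξ, fderiv_clm_apply_apply dGF dDξ, hcomp] at hw
  rw [fderiv_clm_apply_apply dD hξ] at hw
  simp only [add_apply, map_add, hrad.self_of_nhds, fderiv_metric hs dG hi,
    fderiv_fun_const] at hw
  have gauss := gauss_formula (G := G) (hF.of_le two_le_infty) hP w (ξ y₀)
  have h := congrArg (fun V => G (F y₀) (fderiv ℝ F y₀ (ξ y₀)) V) gauss
  simp only [map_add, map_smul, hrad.self_of_nhds, smul_eq_mul, christoffelL_apply] at h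
  have e1 := hs (F y₀) (fderiv ℝ F y₀ (ξ y₀)) (fderiv ℝ (fderiv ℝ F) y₀ w (ξ y₀))
  have e2 := hs (F y₀) (fderiv ℝ F y₀ (ξ y₀))
    (christoffel G (F y₀) (fderiv ℝ F y₀ w) (fderiv ℝ F y₀ (ξ y₀)))
  -- The Gauss formula is applied to the constant field with value `ξ y₀`. It differs from the true
  -- derivative by `dF(∂_w ξ)`, which is tangent and so orthogonal to the radical. What remains is
  -- `B(w,ξ) G(dF ξ, n) = 0`.
  have e3 := hs (F y₀) (fderiv ℝ F y₀ (ξ y₀)) (fderiv ℝ F y₀ (fderiv ℝ ξ y₀ w))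
  rw [hrad.self_of_nhds] at e3
  have : localSecondForm G F n y₀ w (ξ y₀) * G (F y₀) (fderiv ℝ F y₀ (ξ y₀)) (n y₀) = 0 := by
    simp only [Pi.zero_apply, zero_apply] at hw
    linarith
  exact (mul_eq_zero.1 this).resolve_right hpair

variable [CompleteSpace E] [CompleteSpace E']

/-- Makes the induced Christoffel symbols and `B` differentiable, so that the Gauss formula can be
differentiated once more. -/
theorem contDiffAt_inducedDecomp (hG : ContDiffAt ℝ ∞ G (F y₀)) (hi : (G (F y₀)).IsInvertible)
    (hF : ContDiffAt ℝ ∞ F y₀) (hn : ContDiffAt ℝ ∞ n y₀) (hP : (frameMap F n y₀).IsInvertible)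
    (w z : E) : ContDiffAt ℝ ∞ (fun y => decomp F (n y) y
      (covAlong G F (fun y' => fderiv ℝ F y' z) y w)) y₀ := by
  have hD : ContDiffAt ℝ ∞ (fderiv ℝ F) y₀ := hF.fderiv_right le_rfl
  have hD2 : ContDiffAt ℝ ∞ (fderiv ℝ (fderiv ℝ F)) y₀ := hD.fderiv_right le_rfl
  have hinv : ContDiffAt ℝ ∞ (fun y => (frameMap F n y).inverse) y₀ :=
    ContDiffAt.comp y₀ hP.contDiffAt_map_inverse (contDiffAt_frameMap hF hn)
  have hΓ : ContDiffAt ℝ ∞ (fun y => christoffelL G (F y)) y₀ :=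
    ContDiffAt.comp y₀ (contDiffAt_christoffelL hG hi) hF
  have hDc : ∀ w, ContDiffAt ℝ ∞ (fun y => fderiv ℝ F y w) y₀ := fun w =>
    hD.clm_apply contDiffAt_const
  have h := hinv.clm_apply (((hD2.clm_apply (contDiffAt_const (c := w))).clm_apply
    (contDiffAt_const (c := z))).add ((hΓ.clm_apply (hDc w)).clm_apply (hDc z)))
  refine h.congr_of_eventuallyEq ?_
  filter_upwards [eventually_contDiffAt_two hF] with y hy
  rw [covAlong_fderiv_eq hy]
  rfl

/-- The Gauss equation, up to its transversal part. -/
theorem gauss_equation (hG : ContDiffAt ℝ ∞ G (F y₀))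
    (hi : (G (F y₀)).IsInvertible) (hF : ContDiffAt ℝ ∞ F y₀) (hn : ContDiffAt ℝ ∞ n y₀)
    (hP : (frameMap F n y₀).IsInvertible) (v w z : E) :
    ∃ r : ℝ, fderiv ℝ F y₀ (curvatureOf (inducedChristoffel G F n) y₀ v w z) + r • n y₀ =
      curvatureOf (christoffel G) (F y₀) (fderiv ℝ F y₀ v) (fderiv ℝ F y₀ w) (fderiv ℝ F y₀ z)
      + localSecondForm G F n y₀ w z • fderiv ℝ F y₀ (localShape G F n y₀ v)
      - localSecondForm G F n y₀ v z • fderiv ℝ F y₀ (localShape G F n y₀ w) := by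
  have cst : ∀ a : E, DifferentiableAt ℝ (fun _ : E => a) y₀ := fun a => differentiableAt_const a
  have dF : DifferentiableAt ℝ F y₀ := hF.differentiableAt (by simp)
  have hD : ContDiffAt ℝ ∞ (fderiv ℝ F) y₀ := hF.fderiv_right le_rfl
  have dD : DifferentiableAt ℝ (fderiv ℝ F) y₀ := hD.differentiableAt (by simp)
  have dD2 : DifferentiableAt ℝ (fderiv ℝ (fderiv ℝ F)) y₀ :=
    (hD.fderiv_right (m := ∞) le_rfl).differentiableAt (by simp)
  have dn : DifferentiableAt ℝ n y₀ := hn.differentiableAt (by simp)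
  have dΓ : DifferentiableAt ℝ (christoffelL G) (F y₀) :=
    (contDiffAt_christoffelL hG hi).differentiableAt (by simp)
  have dΓF : DifferentiableAt ℝ (fun y => christoffelL G (F y)) y₀ :=
    DifferentiableAt.comp y₀ dΓ dF
  have dDc : ∀ w, DifferentiableAt ℝ (fun y => fderiv ℝ F y w) y₀ := fun w =>
    dD.clm_apply (cst w)
  have hd : ∀ w z, DifferentiableAt ℝ (fun y => decomp F (n y) y
      (covAlong G F (fun y' => fderiv ℝ F y' z) y w)) y₀ := fun w z =>
    (contDiffAt_inducedDecomp hG hi hF hn hP w z).differentiableAt (by simp)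
  have dX : ∀ w z, DifferentiableAt ℝ (fun y => inducedChristoffel G F n y w z) y₀ := fun w z =>
    (hd w z).fst
  have db : ∀ w z, DifferentiableAt ℝ (fun y => localSecondForm G F n y w z) y₀ := fun w z =>
    (hd w z).snd
  have h2 : ContDiffAt ℝ 2 F y₀ := hF.of_le two_le_infty
  have gauss := gauss_formula (G := G) h2 hP
  -- The coordinate derivative along `v` of the Gauss formula for `w`, `z`. Adding `app`, the
  -- ambient Christoffel terms, turns it into the covariant derivative.
  have key : ∀ v w : E,
      fderiv ℝ F y₀ (fderiv ℝ (fun y => inducedChristoffel G F n y w z) y₀ v)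
        + fderiv ℝ (fderiv ℝ F) y₀ v (inducedChristoffel G F n y₀ w z)
        + (localSecondForm G F n y₀ w z • fderiv ℝ n y₀ v
          + fderiv ℝ (fun y => localSecondForm G F n y w z) y₀ v • n y₀)
      = fderiv ℝ (fderiv ℝ (fderiv ℝ F)) y₀ v w z
        + (christoffelL G (F y₀) (fderiv ℝ F y₀ w) (fderiv ℝ (fderiv ℝ F) y₀ v z)
          + (christoffelL G (F y₀) (fderiv ℝ (fderiv ℝ F) y₀ v w) (fderiv ℝ F y₀ z)
            + fderiv ℝ (christoffelL G) (F y₀) (fderiv ℝ F y₀ v) (fderiv ℝ F y₀ w)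
              (fderiv ℝ F y₀ z))) := fun v w => by
    have hev : (fun y => fderiv ℝ F y (inducedChristoffel G F n y w z)
          + localSecondForm G F n y w z • n y) =ᶠ[𝓝 y₀]
        fun y => fderiv ℝ (fderiv ℝ F) y w z
          + christoffelL G (F y) (fderiv ℝ F y w) (fderiv ℝ F y z) := by
      filter_upwards [eventually_contDiffAt_two hF,
        eventually_isInvertible (contDiffAt_frameMap hF hn).continuousAt hP] with y h1 h2
      exact gauss_formula h1 h2 w z
    have hv := congrArg (fun L : E →L[ℝ] E' => L v) hev.fderiv_eq
    have dΓw := dΓF.clm_apply (dDc w)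
    have dD2w := dD2.clm_apply (cst w)
    rw [fderiv_fun_add (dD.clm_apply (dX w z)) ((db w z).fun_smul dn),
      fderiv_fun_add (dD2w.clm_apply (cst z)) (dΓw.clm_apply (dDc z)),
      fderiv_fun_smul (db w z) dn] at hv
    simp only [add_apply, smul_apply, ContinuousLinearMap.smulRight_apply] at hv
    have hcomp : fderiv ℝ (fun y => christoffelL G (F y)) y₀ v
        = fderiv ℝ (christoffelL G) (F y₀) (fderiv ℝ F y₀ v) := by
      rw [fderiv_fun_comp y₀ dΓ dF]; rfl
    rw [fderiv_clm_apply_apply dD (dX w z), fderiv_clm_apply_const dD2w,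
      fderiv_clm_apply_const dD2, fderiv_clm_apply_apply dΓw (dDc z),
      fderiv_clm_apply_const dD, fderiv_clm_apply_apply dΓF (dDc w),
      fderiv_clm_apply_const dD, hcomp] at hv
    simpa only [add_apply] using hv
  have app : ∀ v w : E, christoffelL G (F y₀) (fderiv ℝ F y₀ v)
        (fderiv ℝ F y₀ (inducedChristoffel G F n y₀ w z))
      + localSecondForm G F n y₀ w z • christoffelL G (F y₀) (fderiv ℝ F y₀ v) (n y₀)
      = christoffelL G (F y₀) (fderiv ℝ F y₀ v) (fderiv ℝ (fderiv ℝ F) y₀ w z)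
      + christoffelL G (F y₀) (fderiv ℝ F y₀ v)
        (christoffelL G (F y₀) (fderiv ℝ F y₀ w) (fderiv ℝ F y₀ z)) := fun v w => by
    rw [← map_smul, ← map_add, gauss, map_add]
  obtain ⟨τv, hτv⟩ := weingarten_formula (G := G) hP v
  obtain ⟨τw, hτw⟩ := weingarten_formula (G := G) hP w
  -- The transversal coefficient is the Codazzi expression: derivative of `B`, `B` with the
  -- connection, and the `τ` terms, antisymmetrized in `v`, `w`.
  refine ⟨fderiv ℝ (fun y => localSecondForm G F n y w z) y₀ v
    + localSecondForm G F n y₀ v (inducedChristoffel G F n y₀ w z)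
    + localSecondForm G F n y₀ w z * τv
    - (fderiv ℝ (fun y => localSecondForm G F n y v z) y₀ w
    + localSecondForm G F n y₀ w (inducedChristoffel G F n y₀ v z)
    + localSecondForm G F n y₀ v z * τw), ?_⟩
  have k1 := key v w
  have k2 := key w v
  -- Third and second derivatives of `F` are symmetric in `v`, `w`, so they drop out on
  -- antisymmetrizing. The iterated connection terms come from `gauss` and the derivatives of `n`
  -- from the Weingarten formula.
  rw [fderiv_fderiv_symm hD, fderiv_fderiv_symm hF v w] at k1
  rw [curvatureOf_christoffel_eq hG hi, curvatureOf]
  simp only [map_add, map_sub]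
  linear_combination (norm := module) k1 - k2 + gauss v (inducedChristoffel G F n y₀ w z)
    - gauss w (inducedChristoffel G F n y₀ v z) + app v w - app w v
    - localSecondForm G F n y₀ w z • hτv + localSecondForm G F n y₀ v z • hτw

end GaussWeingarten

/-! ### Tangent vectors, metrics and fields read in preferred charts. -/

section Charts

variable {E : Type*} [NormedAddCommGroup E] [NormedSpace ℝ E]
  {M : Type*} [TopologicalSpace M] [ChartedSpace E M] [IsManifold 𝓘(ℝ, E) ∞ M]
  {E' : Type*} [NormedAddCommGroup E'] [NormedSpace ℝ E']
  {N : Type*} [TopologicalSpace N] [ChartedSpace E' N] [IsManifold 𝓘(ℝ, E') ∞ N]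

theorem isManifold_one : IsManifold 𝓘(ℝ, E) 1 M :=
  IsManifold.of_le (n := ∞) (by exact_mod_cast le_top)

theorem mfderiv_extChartAt_symm_apply {x p : M} (hp : p ∈ (chartAt E x).source)
    (v : TangentSpace 𝓘(ℝ, E) p) :
    mfderiv 𝓘(ℝ, E) 𝓘(ℝ, E) (extChartAt 𝓘(ℝ, E) x).symm (extChartAt 𝓘(ℝ, E) x p)
      (mfderiv 𝓘(ℝ, E) 𝓘(ℝ, E) (extChartAt 𝓘(ℝ, E) x) p v) = v := by
  have : IsManifold 𝓘(ℝ, E) 1 M := isManifold_one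
  have h := mfderivWithin_extChartAt_symm_comp_mfderiv_extChartAt' (I := 𝓘(ℝ, E)) (x := x) (y := p)
    (by simpa using hp)
  rw [modelWithCornersSelf_coe, Set.range_id, mfderivWithin_univ] at h
  exact congrArg (fun L => L v) h

theorem mfderiv_extChartAt_apply_symm {x p : M} (hp : p ∈ (chartAt E x).source)
    (v : E) :
    mfderiv 𝓘(ℝ, E) 𝓘(ℝ, E) (extChartAt 𝓘(ℝ, E) x) p
      (mfderiv 𝓘(ℝ, E) 𝓘(ℝ, E) (extChartAt 𝓘(ℝ, E) x).symm (extChartAt 𝓘(ℝ, E) x p) v) = v := by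
  have : IsManifold 𝓘(ℝ, E) 1 M := isManifold_one
  have h := mfderiv_extChartAt_comp_mfderivWithin_extChartAt_symm' (I := 𝓘(ℝ, E)) (x := x) (y := p)
    (by simpa using hp)
  rw [modelWithCornersSelf_coe, Set.range_id, mfderivWithin_univ] at h
  exact congrArg (fun L => L v) h

/-- A tangent vector at `x` is its own coordinate vector in the preferred chart at `x`; this lets
coordinate formulas be read at the base point without conversion. -/
theorem mfderiv_extChartAt_self (x : M) (v : TangentSpace 𝓘(ℝ, E) x) :
    mfderiv 𝓘(ℝ, E) 𝓘(ℝ, E) (extChartAt 𝓘(ℝ, E) x) x v = v := by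
  have : IsManifold 𝓘(ℝ, E) 1 M := isManifold_one
  rw [← TangentBundle.continuousLinearMapAt_trivializationAt (mem_chart_source E x),
    TangentBundle.continuousLinearMapAt_trivializationAt_eq_core (mem_chart_source E x)]
  exact (tangentBundleCore 𝓘(ℝ, E) M).coordChange_self (achart E x) x (mem_chart_source E x) v

theorem metricInChart_mfderiv (g : SemiRiemannianMetric E' N) {x q : N}
    (hq : q ∈ (chartAt E' x).source) (v w : TangentSpace 𝓘(ℝ, E') q) :
    metricInChart g x (extChartAt 𝓘(ℝ, E') x q)
      (mfderiv 𝓘(ℝ, E') 𝓘(ℝ, E') (extChartAt 𝓘(ℝ, E') x) q v)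
      (mfderiv 𝓘(ℝ, E') 𝓘(ℝ, E') (extChartAt 𝓘(ℝ, E') x) q w) = g.val q v w := by
  -- The chart round trip returns `q` only up to a propositional equality, so the forms are compared
  -- on the common model space `E'`.
  have key : ∀ q' : N, q' = q → ∀ v w : E',
      (g.val q' : E' →L[ℝ] E' →L[ℝ] ℝ) v w = (g.val q : E' →L[ℝ] E' →L[ℝ] ℝ) v w := by
    rintro q' rfl v w; rfl
  have h := key _ ((extChartAt 𝓘(ℝ, E') x).left_inv (by simpa using hq)) v w
  refine Eq.trans ?_ h
  conv_rhs => rw [← mfderiv_extChartAt_symm_apply hq v, ← mfderiv_extChartAt_symm_apply hq w]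
  rfl

theorem metricInChart_self (g : SemiRiemannianMetric E' N) (x : N)
    (v w : TangentSpace 𝓘(ℝ, E') x) :
    metricInChart g x (extChartAt 𝓘(ℝ, E') x x) v w = g.val x v w := by
  have h := metricInChart_mfderiv g (mem_chart_source E' x) v w
  rwa [mfderiv_extChartAt_self, mfderiv_extChartAt_self] at h

theorem metricInChart_symm (g : SemiRiemannianMetric E' N) (x : N) (y v w : E') :
    metricInChart g x y v w = metricInChart g x y w v :=
  g.symm _ (mfderiv 𝓘(ℝ, E') 𝓘(ℝ, E') (extChartAt 𝓘(ℝ, E') x).symm y v)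
    (mfderiv 𝓘(ℝ, E') 𝓘(ℝ, E') (extChartAt 𝓘(ℝ, E') x).symm y w)

theorem isInvertible_of_nondegenerate [FiniteDimensional ℝ E'] (A : E' →L[ℝ] E' →L[ℝ] ℝ)
    (hA : ∀ v, (∀ w, A v w = 0) → v = 0) : A.IsInvertible := by
  have hinj : Function.Injective A.toLinearMap := (injective_iff_map_eq_zero _).2 fun v hv =>
    hA v fun w => congrArg (fun L : E' →L[ℝ] ℝ => L w) hv
  have hdim : Module.finrank ℝ E' = Module.finrank ℝ (E' →L[ℝ] ℝ) := by
    rw [← (LinearMap.toContinuousLinearMap : (E' →ₗ[ℝ] ℝ) ≃ₗ[ℝ] _).finrank_eq]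
    exact Subspace.dual_finrank_eq.symm
  exact ⟨(LinearEquiv.ofInjectiveOfFinrankEq A.toLinearMap hinj hdim).toContinuousLinearEquiv,
    ContinuousLinearMap.ext fun _ => rfl⟩

theorem isInvertible_metricInChart [FiniteDimensional ℝ E'] (g : SemiRiemannianMetric E' N)
    (x : N) : (metricInChart g x (extChartAt 𝓘(ℝ, E') x x)).IsInvertible :=
  isInvertible_of_nondegenerate _ fun v hv => g.nondegenerate x v fun w => by
    rw [← metricInChart_self g x v w]
    exact hv w

/-- The tangent bundle trivialization at `f u` is the derivative of the preferred chart, so the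
fibre component of the smooth section is the coordinate field. -/
theorem contDiffAt_alongInChart {f : M → N} {u : M}
    {ν : ∀ p : M, TangentSpace 𝓘(ℝ, E') (f p)}
    (hν : ContMDiffAt 𝓘(ℝ, E) 𝓘(ℝ, E').tangent ∞
      (fun p => (⟨f p, ν p⟩ : TangentBundle 𝓘(ℝ, E') N)) u) :
    ContDiffAt ℝ ∞ (alongInChart f ν u) (extChartAt 𝓘(ℝ, E) u u) := by
  have : IsManifold 𝓘(ℝ, E') 1 N := isManifold_one
  obtain ⟨hf, h⟩ := Bundle.contMDiffAt_totalSpace.1 hν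
  have h' : ContMDiffAt 𝓘(ℝ, E) 𝓘(ℝ, E') ∞ (fun p : M =>
      (mfderiv 𝓘(ℝ, E') 𝓘(ℝ, E') (extChartAt 𝓘(ℝ, E') (f u)) (f p) (ν p) : E')) u := by
    refine h.congr_of_eventuallyEq ?_
    filter_upwards [hf.continuousAt.preimage_mem_nhds
      ((chartAt E' (f u)).open_source.mem_nhds (mem_chart_source E' (f u)))] with p hp
    rw [← TangentBundle.continuousLinearMapAt_trivializationAt hp]
    exact ((trivializationAt E' (TangentSpace 𝓘(ℝ, E')) (f u)).continuousLinearMapAt_apply_of_mem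
      (R := ℝ) hp (ν p))
  have hsymm : ContMDiffAt 𝓘(ℝ, E) 𝓘(ℝ, E) ∞ (extChartAt 𝓘(ℝ, E) u).symm
      (extChartAt 𝓘(ℝ, E) u u) :=
    (contMDiffOn_extChartAt_symm u).contMDiffAt
      ((isOpen_extChartAt_target u).mem_nhds (mem_extChartAt_target u))
  exact (ContMDiffAt.comp_of_eq h' hsymm (extChartAt_to_inv u)).contDiffAt

theorem contDiffAt_metricInChart [FiniteDimensional ℝ E'] (g : SemiRiemannianMetric E' N)
    (x : N) : ContDiffAt ℝ ∞ (metricInChart g x) (extChartAt 𝓘(ℝ, E') x x) := by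
  have : IsManifold 𝓘(ℝ, E') 1 N := isManifold_one
  let e := trivializationAt E' (TangentSpace 𝓘(ℝ, E') : N → Type _) x
  -- Coordinate fields are smooth sections, hence the coefficients of `g` on them are smooth. In
  -- finite dimension, smoothness of all coefficients gives smoothness of the operator-valued map.
  have hsec : ∀ v : E', ContMDiffOn 𝓘(ℝ, E') (𝓘(ℝ, E').prod 𝓘(ℝ, E')) ∞
      (fun p => Bundle.TotalSpace.mk' E' p (e.symmL ℝ p v)) (chartAt E' x).source := fun v => by
    intro p hp
    refine (e.contMDiffWithinAt_section _ hp).2 ?_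
    refine (contMDiffWithinAt_const (c := v)).congr_of_eventuallyEq ?_ ?_
    · filter_upwards [self_mem_nhdsWithin] with q hq
      rw [← e.continuousLinearMapAt_apply_of_mem (R := ℝ) hq]
      exact e.continuousLinearMapAt_symmL hq v
    · rw [← e.continuousLinearMapAt_apply_of_mem (R := ℝ) hp]
      exact e.continuousLinearMapAt_symmL hp v
  have hfun : ∀ v w : E', ContMDiffOn 𝓘(ℝ, E') 𝓘(ℝ, ℝ) ∞
      (fun p => g.val p (e.symmL ℝ p v) (e.symmL ℝ p w)) (chartAt E' x).source := fun v w => by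
    intro p hp
    have h : ContMDiffWithinAt 𝓘(ℝ, E') (𝓘(ℝ, E').prod 𝓘(ℝ, ℝ)) ∞
        (fun m ↦ Bundle.TotalSpace.mk' ℝ (E := Bundle.Trivial N ℝ) m
          (g.val m (e.symmL ℝ m v) (e.symmL ℝ m w))) (chartAt E' x).source p := by
      apply ContMDiffWithinAt.clm_bundle_apply₂ (F₁ := E') (F₂ := E')
      · exact g.contMDiff.contMDiffAt.contMDiffWithinAt
      · exact hsec v p hp
      · exact hsec w p hp
    simp only [Bundle.contMDiffWithinAt_totalSpace] at h
    exact h.2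
  have hon : ∀ v w : E', ContDiffOn ℝ ∞ (fun y => metricInChart g x y v w)
      (extChartAt 𝓘(ℝ, E') x).target := fun v w => by
    rw [← contMDiffOn_iff_contDiffOn]
    have h := (hfun v w).comp (contMDiffOn_extChartAt_symm (n := ∞) (I := 𝓘(ℝ, E')) x)
      (fun y hy => by simpa using (extChartAt 𝓘(ℝ, E') x).map_target hy)
    refine h.congr fun y hy => ?_
    have hsrc : (extChartAt 𝓘(ℝ, E') x).symm y ∈ (chartAt E' x).source := by
      simpa using (extChartAt 𝓘(ℝ, E') x).map_target hy
    have hsy : ∀ v : E', e.symmL ℝ ((extChartAt 𝓘(ℝ, E') x).symm y) v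
        = mfderiv 𝓘(ℝ, E') 𝓘(ℝ, E') (extChartAt 𝓘(ℝ, E') x).symm y v := fun v => by
      have h := TangentBundle.symmL_trivializationAt (I := 𝓘(ℝ, E')) hsrc
      rw [modelWithCornersSelf_coe, Set.range_id, mfderivWithin_univ,
        (extChartAt 𝓘(ℝ, E') x).right_inv hy] at h
      exact congrArg (fun L : E' →L[ℝ] E' => L v) h
    simp only [Function.comp_apply]
    rw [hsy, hsy]
    rfl
  have hC : ContDiffOn ℝ ∞ (metricInChart g x) (extChartAt 𝓘(ℝ, E') x).target :=
    contDiffOn_clm_apply.2 fun v => contDiffOn_clm_apply.2 fun w => hon v w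
  exact hC.contDiffAt ((isOpen_extChartAt_target x).mem_nhds (mem_extChartAt_target x))

end Charts

/-! ### The immersion and the induced metric in charts. -/

section Immersion

variable {E : Type*} [NormedAddCommGroup E] [NormedSpace ℝ E]
  {M : Type*} [TopologicalSpace M] [ChartedSpace E M]
  {E' : Type*} [NormedAddCommGroup E']
  {N : Type*} [TopologicalSpace N] [ChartedSpace E' N]
  {f : M → N}

/-- Coordinates near the base point come from points in the chart domain at `u` whose image lies
in the chart domain at `f u`. -/
theorem eventually_mem_chart_source (hf : Continuous f) (u : M) :
    ∀ᶠ y in 𝓝 (extChartAt 𝓘(ℝ, E) u u), ∃ p : M, p ∈ (chartAt E u).source ∧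
      f p ∈ (chartAt E' (f u)).source ∧ extChartAt 𝓘(ℝ, E) u p = y := by
  have h1 := (continuousAt_extChartAt_symm (I := 𝓘(ℝ, E)) u)
  have hopen := (hf.isOpen_preimage _ (chartAt E' (f u)).open_source).mem_nhds
    (mem_chart_source E' (f u) : u ∈ f ⁻¹' _)
  filter_upwards [(isOpen_extChartAt_target (I := 𝓘(ℝ, E)) u).mem_nhds (mem_extChartAt_target u),
    h1.preimage_mem_nhds (by rw [extChartAt_to_inv]; exact hopen)] with y hy hy'
  exact ⟨(extChartAt 𝓘(ℝ, E) u).symm y,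
    by simpa using (extChartAt 𝓘(ℝ, E) u).map_target hy, hy',
    (extChartAt 𝓘(ℝ, E) u).right_inv hy⟩

variable [NormedSpace ℝ E']

theorem mapInChart_self (f : M → N) (u : M) :
    mapInChart (E := E) (E' := E') f u (extChartAt 𝓘(ℝ, E) u u)
      = extChartAt 𝓘(ℝ, E') (f u) (f u) := by
  simp [mapInChart, writtenInExtChartAt]

theorem contDiffAt_mapInChart (hf : ContMDiff 𝓘(ℝ, E) 𝓘(ℝ, E') ∞ f) (u : M) :
    ContDiffAt ℝ ∞ (mapInChart (E := E) (E' := E') f u) (extChartAt 𝓘(ℝ, E) u u) := by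
  have h := (contMDiffAt_iff.1 (hf u)).2
  rwa [modelWithCornersSelf_coe, Set.range_id, contDiffWithinAt_univ] at h

theorem alongInChart_extChartAt (ν : ∀ p : M, TangentSpace 𝓘(ℝ, E') (f p)) {u p : M}
    (hp : p ∈ (chartAt E u).source) :
    alongInChart (E := E) f ν u (extChartAt 𝓘(ℝ, E) u p)
      = mfderiv 𝓘(ℝ, E') 𝓘(ℝ, E') (extChartAt 𝓘(ℝ, E') (f u)) (f p) (ν p) := by
  rw [alongInChart, (extChartAt 𝓘(ℝ, E) u).left_inv (by simpa using hp)]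

variable [IsManifold 𝓘(ℝ, E') ∞ N]

theorem alongInChart_self (ν : ∀ p : M, TangentSpace 𝓘(ℝ, E') (f p)) (u : M) :
    alongInChart (E := E) f ν u (extChartAt 𝓘(ℝ, E) u u) = ν u := by
  rw [alongInChart_extChartAt ν (mem_chart_source E u), mfderiv_extChartAt_self]

variable [IsManifold 𝓘(ℝ, E) ∞ M]

/-- The chain rule at every point `p` near `u`, not only at the base point: the radical condition
has to hold in coordinates on a neighbourhood before it is differentiated. -/
theorem fderiv_mapInChart (hf : ContMDiff 𝓘(ℝ, E) 𝓘(ℝ, E') ∞ f) {u p : M}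
    (hp : p ∈ (chartAt E u).source) (hfp : f p ∈ (chartAt E' (f u)).source)
    (v : TangentSpace 𝓘(ℝ, E) p) :
    fderiv ℝ (mapInChart (E := E) (E' := E') f u) (extChartAt 𝓘(ℝ, E) u p)
      (mfderiv 𝓘(ℝ, E) 𝓘(ℝ, E) (extChartAt 𝓘(ℝ, E) u) p v)
      = mfderiv 𝓘(ℝ, E') 𝓘(ℝ, E') (extChartAt 𝓘(ℝ, E') (f u)) (f p)
        (mfderiv 𝓘(ℝ, E) 𝓘(ℝ, E') f p v) := by
  have : IsManifold 𝓘(ℝ, E) 1 M := isManifold_one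
  have : IsManifold 𝓘(ℝ, E') 1 N := isManifold_one
  have hinv : (extChartAt 𝓘(ℝ, E) u).symm (extChartAt 𝓘(ℝ, E) u p) = p :=
    (extChartAt 𝓘(ℝ, E) u).left_inv (by simpa using hp)
  have hφ : MDifferentiableAt 𝓘(ℝ, E) 𝓘(ℝ, E) (extChartAt 𝓘(ℝ, E) u) p :=
    mdifferentiableAt_extChartAt hp
  have hψ : MDifferentiableAt 𝓘(ℝ, E') 𝓘(ℝ, E') (extChartAt 𝓘(ℝ, E') (f u)) (f p) :=
    mdifferentiableAt_extChartAt hfp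
  have hfd : MDifferentiableAt 𝓘(ℝ, E) 𝓘(ℝ, E') f p := (hf p).mdifferentiableAt (by simp)
  have hsymm : MDifferentiableAt 𝓘(ℝ, E) 𝓘(ℝ, E) (extChartAt 𝓘(ℝ, E) u).symm
      (extChartAt 𝓘(ℝ, E) u p) := by
    have h := mdifferentiableWithinAt_extChartAt_symm (I := 𝓘(ℝ, E)) (x := u)
      ((extChartAt 𝓘(ℝ, E) u).map_source (by simpa using hp))
    rwa [modelWithCornersSelf_coe, Set.range_id, mdifferentiableWithinAt_univ] at h
  have hF : MDifferentiableAt 𝓘(ℝ, E) 𝓘(ℝ, E') (mapInChart (E := E) (E' := E') f u)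
      (extChartAt 𝓘(ℝ, E) u p) := by
    have h1 : MDifferentiableAt 𝓘(ℝ, E) 𝓘(ℝ, E') (f ∘ (extChartAt 𝓘(ℝ, E) u).symm)
        (extChartAt 𝓘(ℝ, E) u p) :=
      MDifferentiableAt.comp _ (by rwa [hinv]) hsymm
    have hψ' : MDifferentiableAt 𝓘(ℝ, E') 𝓘(ℝ, E') (extChartAt 𝓘(ℝ, E') (f u))
        ((f ∘ (extChartAt 𝓘(ℝ, E) u).symm) (extChartAt 𝓘(ℝ, E) u p)) := by
      rwa [Function.comp_apply, hinv]
    exact hψ'.comp _ h1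
  have hev : mapInChart (E := E) (E' := E') f u ∘ extChartAt 𝓘(ℝ, E) u
      =ᶠ[𝓝 p] extChartAt 𝓘(ℝ, E') (f u) ∘ f := by
    filter_upwards [(chartAt E u).open_source.mem_nhds hp] with q hq
    simp only [mapInChart, writtenInExtChartAt, Function.comp_apply]
    rw [(extChartAt 𝓘(ℝ, E) u).left_inv (by simpa using hq)]
  have h := hev.mfderiv_eq (I := 𝓘(ℝ, E)) (I' := 𝓘(ℝ, E'))
  rw [mfderiv_comp p hF hφ, mfderiv_comp p hψ hfd, mfderiv_eq_fderiv] at h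
  exact congrArg (fun L => L v) h

variable (g : SemiRiemannianMetric E' N)

theorem metricInChart_fderiv_mapInChart (hf : ContMDiff 𝓘(ℝ, E) 𝓘(ℝ, E') ∞ f) {u p : M}
    (hp : p ∈ (chartAt E u).source) (hfp : f p ∈ (chartAt E' (f u)).source)
    (v : TangentSpace 𝓘(ℝ, E) p) (V : TangentSpace 𝓘(ℝ, E') (f p)) :
    metricInChart g (f u) (mapInChart (E := E) (E' := E') f u (extChartAt 𝓘(ℝ, E) u p))
      (fderiv ℝ (mapInChart (E := E) (E' := E') f u) (extChartAt 𝓘(ℝ, E) u p)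
        (mfderiv 𝓘(ℝ, E) 𝓘(ℝ, E) (extChartAt 𝓘(ℝ, E) u) p v))
      (mfderiv 𝓘(ℝ, E') 𝓘(ℝ, E') (extChartAt 𝓘(ℝ, E') (f u)) (f p) V)
      = g.val (f p) (mfderiv 𝓘(ℝ, E) 𝓘(ℝ, E') f p v) V := by
  rw [fderiv_mapInChart hf hp hfp, ← metricInChart_mfderiv g hfp]
  simp only [mapInChart, writtenInExtChartAt, Function.comp_apply]
  rw [(extChartAt 𝓘(ℝ, E) u).left_inv (by simpa using hp)]

theorem inducedMetric_eq_inChart (hf : ContMDiff 𝓘(ℝ, E) 𝓘(ℝ, E') ∞ f) {u p : M}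
    (hp : p ∈ (chartAt E u).source) (hfp : f p ∈ (chartAt E' (f u)).source)
    (v w : TangentSpace 𝓘(ℝ, E) p) :
    metricInChart g (f u) (mapInChart (E := E) (E' := E') f u (extChartAt 𝓘(ℝ, E) u p))
      (fderiv ℝ (mapInChart (E := E) (E' := E') f u) (extChartAt 𝓘(ℝ, E) u p)
        (mfderiv 𝓘(ℝ, E) 𝓘(ℝ, E) (extChartAt 𝓘(ℝ, E) u) p v))
      (fderiv ℝ (mapInChart (E := E) (E' := E') f u) (extChartAt 𝓘(ℝ, E) u p)
        (mfderiv 𝓘(ℝ, E) 𝓘(ℝ, E) (extChartAt 𝓘(ℝ, E) u) p w))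
      = inducedMetric g f p v w := by
  rw [fderiv_mapInChart hf hp hfp w, metricInChart_fderiv_mapInChart g hf hp hfp]
  rfl

end Immersion

/-! ### Space forms and their hypersurfaces in coordinates. -/

section Coordinates

variable {E : Type*} [NormedAddCommGroup E] [NormedSpace ℝ E]
  {E' : Type*} [NormedAddCommGroup E'] [NormedSpace ℝ E']

/-- The curvature operator of a metric of constant sectional curvature, at a point with a
hyperbolic pair `e`, `n` of vectors. -/
theorem curvatureOf_christoffel_eq_of_sectional [CompleteSpace E] {G : E → E →L[ℝ] E →L[ℝ] ℝ}
    {y₀ : E} (hG : ContDiffAt ℝ ∞ G y₀) (hs : ∀ y v w, G y v w = G y w v)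
    (hi : (G y₀).IsInvertible) {e n : E} (he : G y₀ e e = 0) (hn : G y₀ n n = 0)
    (hen : G y₀ e n = 1) {c : ℝ}
    (hc : ∀ v w, G y₀ v v * G y₀ w w - G y₀ v w ^ 2 ≠ 0 →
      G y₀ (curvatureOf (christoffel G) y₀ v w w) v
        / (G y₀ v v * G y₀ w w - G y₀ v w ^ 2) = c) (v w z : E) :
    curvatureOf (christoffel G) y₀ v w z = c • (G y₀ w z • v - G y₀ v z • w) := by
  let b : E →ₗ[ℝ] E →ₗ[ℝ] ℝ := LinearMap.mk₂ ℝ (fun v w : E => G y₀ v w)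
    (fun _ _ _ => by simp) (fun _ _ _ => by simp) (fun _ _ _ => by simp) (fun _ _ _ => by simp)
  have key := (isAlgebraicCurvature_curvatureOf hG hs hi).eq_of_sectional
    (fun v v' w z t => by
      simp only [curvatureOf_christoffel_eq hG hi, map_add, map_sub, add_apply, sub_apply]; ring)
    (fun r v w z t => by
      simp only [curvatureOf_christoffel_eq hG hi, map_add, map_sub, map_smul, add_apply,
        sub_apply, smul_apply, smul_eq_mul]; ring)
    b (hs y₀) (e := e) (n := n) (c := c) he hn hen hc
  -- Nondegeneracy of the metric upgrades the identity of (0,4) tensors to one of operators.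
  refine hi.injective (ContinuousLinearMap.ext fun t => (key v w z t).trans ?_)
  simp only [map_sub, map_smul, sub_apply, smul_apply, smul_eq_mul]
  rfl

/-- `φ` vanishes on the tangent space but not on `n`, so `n` is transversal and the frame map is
injective; dimensions agree. For a lightlike hypersurface, `φ` is `g(ξ, ·)`. -/
theorem isInvertible_frameMap [FiniteDimensional ℝ E] [FiniteDimensional ℝ E'] {F n : E → E'}
    {y₀ : E} (hdim : Module.finrank ℝ E' = Module.finrank ℝ E + 1)
    (hinj : Function.Injective (fderiv ℝ F y₀)) (φ : E' →L[ℝ] ℝ)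
    (hφ : ∀ v, φ (fderiv ℝ F y₀ v) = 0) (hn : φ (n y₀) ≠ 0) :
    (frameMap F n y₀).IsInvertible := by
  have hP : Function.Injective (frameMap F n y₀).toLinearMap :=
    (injective_iff_map_eq_zero _).2 fun p hp => by
    replace hp : fderiv ℝ F y₀ p.1 + p.2 • n y₀ = 0 := (frameMap_apply F n y₀ p).symm.trans hp
    have h2 : p.2 = 0 := by
      have h0 := congrArg φ hp
      rw [map_add, map_smul, hφ, map_zero, zero_add, smul_eq_mul] at h0
      exact (mul_eq_zero.1 h0).resolve_right hn
    rw [h2, zero_smul, add_zero] at hp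
    exact Prod.ext ((injective_iff_map_eq_zero _).1 hinj p.1 hp) h2
  have hd : Module.finrank ℝ (E × ℝ) = Module.finrank ℝ E' := by
    rw [hdim, Module.finrank_prod, Module.finrank_self]
  exact ⟨(LinearEquiv.ofInjectiveOfFinrankEq (frameMap F n y₀).toLinearMap hP
    hd).toContinuousLinearEquiv, ContinuousLinearMap.ext fun _ => rfl⟩

/-- The Gauss equation for a hypersurface of a space form. -/
theorem curvatureOf_inducedChristoffel_eq [CompleteSpace E] [CompleteSpace E']
    {G : E' → E' →L[ℝ] E' →L[ℝ] ℝ} {F n : E → E'} {y₀ : E}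
    (hG : ContDiffAt ℝ ∞ G (F y₀))
    (hi : (G (F y₀)).IsInvertible) (hF : ContDiffAt ℝ ∞ F y₀) (hn : ContDiffAt ℝ ∞ n y₀)
    (hP : (frameMap F n y₀).IsInvertible) {c : ℝ}
    (hR : ∀ v w z, curvatureOf (christoffel G) (F y₀) v w z
      = c • (G (F y₀) w z • v - G (F y₀) v z • w)) (x y z : E) :
    curvatureOf (inducedChristoffel G F n) y₀ x y z
      = c • (G (F y₀) (fderiv ℝ F y₀ y) (fderiv ℝ F y₀ z) • x
          - G (F y₀) (fderiv ℝ F y₀ x) (fderiv ℝ F y₀ z) • y)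
        + localSecondForm G F n y₀ y z • localShape G F n y₀ x
        - localSecondForm G F n y₀ x z • localShape G F n y₀ y := by
  obtain ⟨r, hr⟩ := gauss_equation hG hi hF hn hP x y z
  rw [hR] at hr
  -- In a space form the right side of the Gauss equation is tangent, so uniqueness of the
  -- decomposition identifies the tangential components.
  refine congrArg Prod.fst (hP.injective (a₁ := (_, r)) (a₂ := (_, 0)) ?_)
  rw [frameMap_apply, frameMap_apply]
  refine hr.trans ?_
  simp only [map_add, map_sub, map_smul, zero_smul, add_zero]

end Coordinates

/-! ### Lightlike hypersurfaces of space forms and the two implications. -/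

section Hypersurface

variable {E : Type*} [NormedAddCommGroup E] [NormedSpace ℝ E]
  {M : Type*} [TopologicalSpace M] [ChartedSpace E M]
  {E' : Type*} [NormedAddCommGroup E'] [NormedSpace ℝ E']
  {N : Type*} [TopologicalSpace N] [ChartedSpace E' N] [IsManifold 𝓘(ℝ, E') ∞ N]
  {f : M → N} {g : SemiRiemannianMetric E' N}

theorem inducedMetric_symm (u : M) (x y : TangentSpace 𝓘(ℝ, E) u) :
    inducedMetric g f u x y = inducedMetric g f u y x :=
  g.symm (f u) (mfderiv 𝓘(ℝ, E) 𝓘(ℝ, E') f u x) (mfderiv 𝓘(ℝ, E) 𝓘(ℝ, E') f u y)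

theorem metricInChart_mapInChart_self (u : M) (V W : TangentSpace 𝓘(ℝ, E') (f u)) :
    metricInChart g (f u) (mapInChart (E := E) (E' := E') f u (extChartAt 𝓘(ℝ, E) u u)) V W
      = g.val (f u) V W := by
  rw [mapInChart_self, metricInChart_self]

theorem metricInChart_eq_val (u : M) :
    metricInChart g (f u) (mapInChart (E := E) (E' := E') f u (extChartAt 𝓘(ℝ, E) u u))
      = (g.val (f u) : E' →L[ℝ] E' →L[ℝ] ℝ) :=
  ContinuousLinearMap.ext fun V => ContinuousLinearMap.ext fun W =>
    metricInChart_mapInChart_self u V W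

theorem secondForm_symm [FiniteDimensional ℝ E'] (hf : IsLightlikeHypersurface (E := E) g f)
    (ν : ∀ p : M, TangentSpace 𝓘(ℝ, E') (f p)) (u : M)
    (x y : TangentSpace 𝓘(ℝ, E) u) : secondForm g f ν u x y = secondForm g f ν u y x := by
  have hG := contDiffAt_metricInChart g (f u)
  rw [← mapInChart_self (E := E)] at hG
  exact localSecondForm_symm (hG.differentiableAt (by simp)) (metricInChart_symm g (f u))
    (contDiffAt_mapInChart hf.contMDiff u) x y

variable [IsManifold 𝓘(ℝ, E) ∞ M]

theorem fderiv_mapInChart_self (hf : ContMDiff 𝓘(ℝ, E) 𝓘(ℝ, E') ∞ f) (u : M)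
    (v : TangentSpace 𝓘(ℝ, E) u) :
    fderiv ℝ (mapInChart (E := E) (E' := E') f u) (extChartAt 𝓘(ℝ, E) u u) v
      = mfderiv 𝓘(ℝ, E) 𝓘(ℝ, E') f u v := by
  have h := fderiv_mapInChart hf (mem_chart_source E u) (mem_chart_source E' (f u)) v
  rwa [mfderiv_extChartAt_self, mfderiv_extChartAt_self] at h

variable {S : Screen (E := E) g f} {U : Set M} {ξ : ∀ p : M, TangentSpace 𝓘(ℝ, E) p}
  {ν : ∀ p : M, TangentSpace 𝓘(ℝ, E') (f p)} {u : M}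

theorem inducedMetric_eq (hf : ContMDiff 𝓘(ℝ, E) 𝓘(ℝ, E') ∞ f) (u : M)
    (x y : TangentSpace 𝓘(ℝ, E) u) :
    metricInChart g (f u) (mapInChart (E := E) (E' := E') f u (extChartAt 𝓘(ℝ, E) u u))
      (fderiv ℝ (mapInChart (E := E) (E' := E') f u) (extChartAt 𝓘(ℝ, E) u u) x)
      (fderiv ℝ (mapInChart (E := E) (E' := E') f u) (extChartAt 𝓘(ℝ, E) u u) y)
      = inducedMetric g f u x y := by
  have h := inducedMetric_eq_inChart g hf (mem_chart_source E u) (mem_chart_source E' (f u)) x y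
  rwa [mfderiv_extChartAt_self, mfderiv_extChartAt_self] at h

theorem IsNormalizingPair.pairing_inChart (hf : ContMDiff 𝓘(ℝ, E) 𝓘(ℝ, E') ∞ f)
    (h : IsNormalizingPair S U ξ ν) (hu : u ∈ U) :
    metricInChart g (f u) (mapInChart (E := E) (E' := E') f u (extChartAt 𝓘(ℝ, E) u u))
      (fderiv ℝ (mapInChart (E := E) (E' := E') f u) (extChartAt 𝓘(ℝ, E) u u) (ξ u))
      (alongInChart (E := E) f ν u (extChartAt 𝓘(ℝ, E) u u)) = 1 := by
  rw [fderiv_mapInChart_self hf, alongInChart_self, metricInChart_mapInChart_self]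
  exact h.pairing u hu

theorem IsNormalizingPair.null_inChart (h : IsNormalizingPair S U ξ ν) (hu : u ∈ U) :
    metricInChart g (f u) (mapInChart (E := E) (E' := E') f u (extChartAt 𝓘(ℝ, E) u u))
      (alongInChart (E := E) f ν u (extChartAt 𝓘(ℝ, E) u u))
      (alongInChart (E := E) f ν u (extChartAt 𝓘(ℝ, E) u u)) = 0 := by
  rw [alongInChart_self, metricInChart_mapInChart_self]
  exact h.null u hu

theorem IsNormalizingPair.contDiffAt_trans (h : IsNormalizingPair S U ξ ν) (hu : u ∈ U) :
    ContDiffAt ℝ ∞ (alongInChart (E := E) f ν u) (extChartAt 𝓘(ℝ, E) u u) :=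
  contDiffAt_alongInChart (h.smooth_trans.contMDiffAt (h.isOpen.mem_nhds hu))

variable [FiniteDimensional ℝ E] [FiniteDimensional ℝ E']

theorem IsNormalizingPair.isInvertible_frameMap
    (hf : IsLightlikeHypersurface (E := E) g f)
    (h : IsNormalizingPair S U ξ ν) (hu : u ∈ U) :
    (frameMap (mapInChart (E := E) (E' := E') f u) (alongInChart (E := E) f ν u)
      (extChartAt 𝓘(ℝ, E) u u)).IsInvertible := by
  refine Lightlike.isInvertible_frameMap hf.codim_one ?_
    (metricInChart g (f u) (mapInChart (E := E) (E' := E') f u (extChartAt 𝓘(ℝ, E) u u))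
      (fderiv ℝ (mapInChart (E := E) (E' := E') f u) (extChartAt 𝓘(ℝ, E) u u) (ξ u)))
    (fun v => ?_) ?_
  · intro v w hvw
    exact hf.injective_mfderiv u ((fderiv_mapInChart_self hf.contMDiff u v).symm.trans
      (hvw.trans (fderiv_mapInChart_self hf.contMDiff u w)))
  · exact (inducedMetric_eq hf.contMDiff u (ξ u) v).trans (h.mem_radical u hu v)
  · rw [h.pairing_inChart hf.contMDiff hu]
    exact one_ne_zero

/-- The Gauss equation of a lightlike hypersurface in a space form. -/
theorem IsNormalizingPair.inducedCurvature_eq (hf : IsLightlikeHypersurface (E := E) g f)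
    {c : ℝ} (hc : HasConstantSectionalCurvature g c)
    (h : IsNormalizingPair S U ξ ν) (hu : u ∈ U) (x y z : TangentSpace 𝓘(ℝ, E) u) :
    inducedCurvature g f ν u x y z
      = c • (inducedMetric g f u y z • x - inducedMetric g f u x z • y)
        + secondForm g f ν u y z • shape g f ν u x
        - secondForm g f ν u x z • shape g f ν u y := by
  have : CompleteSpace E := FiniteDimensional.complete ℝ E
  have : CompleteSpace E' := FiniteDimensional.complete ℝ E'
  have hG := contDiffAt_metricInChart g (f u)
  have hi := isInvertible_metricInChart g (f u)
  rw [← mapInChart_self (E := E)] at hG hi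
  -- The hyperbolic pair is the normalizing pair itself: `ξ` and `N` are null with product `1`.
  have hR := curvatureOf_christoffel_eq_of_sectional (c := c) hG (metricInChart_symm g (f u)) hi
    ((inducedMetric_eq hf.contMDiff u (ξ u) (ξ u)).trans (h.mem_radical u hu (ξ u)))
    (h.null_inChart hu) (h.pairing_inChart hf.contMDiff hu) fun v w hvw => by
      rw [metricInChart_eq_val] at hvw ⊢
      rw [mapInChart_self]
      exact hc (f u) v w hvw
  have key := curvatureOf_inducedChristoffel_eq hG hi
    (contDiffAt_mapInChart hf.contMDiff u) (h.contDiffAt_trans hu)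
    (h.isInvertible_frameMap hf hu) hR x y z
  rw [inducedMetric_eq hf.contMDiff u y z, inducedMetric_eq hf.contMDiff u x z] at key
  exact key

theorem IsNormalizingPair.secondForm_radical (hf : IsLightlikeHypersurface (E := E) g f)
    (h : IsNormalizingPair S U ξ ν) (hu : u ∈ U) (x : TangentSpace 𝓘(ℝ, E) u) :
    secondForm g f ν u x (ξ u) = 0 := by
  have hP := h.isInvertible_frameMap hf hu
  have hG := contDiffAt_metricInChart g (f u)
  have hi := isInvertible_metricInChart g (f u)
  rw [← mapInChart_self (E := E)] at hG hi
  -- A tangent field is a field along the identity map, so the coordinate expression and smoothness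
  -- of `ξ` come from the results for fields along a map.
  have hξ : ContDiffAt ℝ ∞ (alongInChart (E := E) (id : M → M) ξ u) (extChartAt 𝓘(ℝ, E) u u) :=
    contDiffAt_alongInChart (f := (id : M → M))
      (h.smooth_rad.contMDiffAt (h.isOpen.mem_nhds hu))
  have hself : alongInChart (E := E) (id : M → M) ξ u (extChartAt 𝓘(ℝ, E) u u) = ξ u :=
    alongInChart_self (f := (id : M → M)) ξ u
  have key := localSecondForm_radical hG (metricInChart_symm g (f u)) hi
    (contDiffAt_mapInChart hf.contMDiff u) hP (hξ.differentiableAt (by simp)) ?_ ?_ x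
  · rwa [hself] at key
  · have hUs : (extChartAt 𝓘(ℝ, E) u).symm ⁻¹' U ∈ 𝓝 (extChartAt 𝓘(ℝ, E) u u) :=
      (continuousAt_extChartAt_symm u).preimage_mem_nhds
        (by rw [extChartAt_to_inv]; exact h.isOpen.mem_nhds hu)
    filter_upwards [eventually_mem_chart_source (E' := E') hf.contMDiff.continuous u, hUs]
    rintro _ ⟨p, hp, hfp, rfl⟩ hpU z
    rw [Set.mem_preimage, (extChartAt 𝓘(ℝ, E) u).left_inv (by simpa using hp)] at hpU
    have hA : alongInChart (E := E) (id : M → M) ξ u (extChartAt 𝓘(ℝ, E) u p)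
        = mfderiv 𝓘(ℝ, E) 𝓘(ℝ, E) (extChartAt 𝓘(ℝ, E) u) p (ξ p) :=
      alongInChart_extChartAt (f := (id : M → M)) ξ hp
    have e := inducedMetric_eq_inChart g hf.contMDiff hp hfp (ξ p)
      (mfderiv 𝓘(ℝ, E) 𝓘(ℝ, E) (extChartAt 𝓘(ℝ, E) u).symm (extChartAt 𝓘(ℝ, E) u p) z)
    rw [mfderiv_extChartAt_apply_symm hp z] at e
    rw [hA]
    exact e.trans (h.mem_radical p hpU _)
  · rw [hself, h.pairing_inChart hf.contMDiff hu]
    exact one_ne_zero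

/-- An admissible screen whose field `A_N ξ` is non-null forces the hypersurface to be totally
geodesic. -/
theorem Screen.IsAdmissible.isTotallyGeodesic (hf : IsLightlikeHypersurface (E := E) g f)
    {c : ℝ} (hc : HasConstantSectionalCurvature g c) (hS : S.IsAdmissible)
    (hA : S.IsNonNullShape) : S.IsTotallyGeodesic := by
  intro U ξ ν h u hu x y
  have hR := h.inducedCurvature_eq hf hc hu
  have hB := h.secondForm_radical hf hu
  have hB' : ∀ x, secondForm g f ν u (ξ u) x = 0 := fun x => by
    rw [secondForm_symm hf, hB]
  have hr : ∀ z, inducedMetric g f u (ξ u) z = 0 := h.mem_radical u hu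
  have hr' : ∀ z, inducedMetric g f u z (ξ u) = 0 := fun z =>
    (inducedMetric_symm u z (ξ u)).trans (hr z)
  -- Pair symmetry at `(ξ, x, y, Aξ)`. Every term containing `g(ξ,·)` or `B(ξ,·)` vanishes, leaving
  -- `B(x,y) g(Aξ,Aξ) = 0`.
  have hp := (hS U ξ ν h u hu).2.1 (ξ u) x y (shape g f ν u (ξ u))
  simp only [inducedCurvature₄, hR, map_add, map_sub, map_smul, add_apply, sub_apply, smul_apply,
    hr, hr', hB, hB', smul_eq_mul, mul_zero, zero_mul, sub_zero, add_zero, zero_add] at hp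
  exact (mul_eq_zero.1 hp).resolve_right (hA U ξ ν h u hu)

/-- A totally geodesic lightlike hypersurface of a space form is semi-symmetric. -/
theorem Screen.IsTotallyGeodesic.isSemiSymmetric (hf : IsLightlikeHypersurface (E := E) g f)
    {c : ℝ} (hc : HasConstantSectionalCurvature g c) (hB : S.IsTotallyGeodesic) :
    S.IsSemiSymmetric := by
  intro U ξ ν h u hu v₁ v₂ x y z t
  have hR : ∀ x y z, inducedCurvature g f ν u x y z
      = c • (inducedMetric g f u y z • x - inducedMetric g f u x z • y) := fun x y z => by
    rw [h.inducedCurvature_eq hf hc hu, hB U ξ ν h u hu, hB U ξ ν h u hu, zero_smul, zero_smul,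
      add_zero, sub_zero]
  have hs := inducedMetric_symm (E := E) (g := g) (f := f) u
  simp only [inducedCurvature₄, hR, map_sub, map_smul, sub_apply, smul_apply, smul_eq_mul]
  -- With products of the metric in a common order, the terms cancel in pairs; this is the
  -- skew-adjointness of `R(v₁,v₂)` written out.
  rw [hs y v₁, hs y v₂, hs x v₁, hs x v₂]
  ring

end Hypersurface

end Lightlike

end

theorem theorem5p3
    {E' : Type*} [NormedAddCommGroup E'] [NormedSpace ℝ E'] [FiniteDimensional ℝ E']
    {N : Type*} [TopologicalSpace N] [ChartedSpace E' N] [IsManifold 𝓘(ℝ, E') ∞ N]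
    {E : Type*} [NormedAddCommGroup E] [NormedSpace ℝ E] [FiniteDimensional ℝ E]
    {M : Type*} [TopologicalSpace M] [ChartedSpace E M] [IsManifold 𝓘(ℝ, E) ∞ M]
    (g : SemiRiemannianMetric E' N) (c : ℝ) (hc : HasConstantSectionalCurvature g c)
    (f : M → N) (hf : IsLightlikeHypersurface (E := E) g f)
    (hO : IsPointwiseOsserman (E := E) g f)
    (S : Screen (E := E) g f) (hS : S.IsAdmissible) (hA : S.IsNonNullShape) :
    S.IsSemiSymmetric ↔ S.IsTotallyGeodesic :=
  ⟨fun _ => hS.isTotallyGeodesic hf hc hA, fun h => h.isSemiSymmetric hf hc⟩
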